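/- All matroids are finite. A matroid $M$ has three skew circuits if it has circuits $C_1,C_2,C_3$, necessarily pairwise disjoint, such that $M|(C_1\cup C_2\cup C_3)=(M|C_1)\oplus(M|C_2)\oplus(M|C_3)$. A series minor of $M$ is a matroid obtained from $M$ by a (possibly empty) sequence of deletions of elements and series contractions, where a series contraction of a matroid $N$ is a contraction $N/e$ of an element $e$ that lies in a 2-element cocircuit of $N$. The cycle matroid of a multigraph $G$ is denoted $M(G)$. Theorem. Let $M$ be a connected binary matroid with three skew circuits. Then $M$ has a series minor isomorphic to $M(L_i)$ for some $i\in\{1,2,3,4,5\}$, where $L_1,\dots,L_5$ are the following multigraphs (edges are listed with multiplicity, $xy^{(2)}$ denoting two parallel edges joining $x$ and $y$): - $L_1$, on vertices $0,1,2,3$: $01^{(2)},\,12^{(2)},\,23^{(2)},\,30$ (a 4-cycle with three edges doubled). - $L_2$, on vertices $0,1,2,3$: $01^{(2)},\,02^{(2)},\,03^{(2)},\,12,\,23$. - $L_3$, on vertices $0,1,2,3,4$: $01,\,12,\,02,\,03^{(2)},\,32,\,14^{(2)},\,42$. - $L_4$, on vertices $0,1,2,3,4,5$: $01,\,12,\,23,\,30,\,04^{(2)},\,42,\,15^{(2)},\,53$.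 - $L_5$, on vertices $0,1,2,3,4$: $01,\,02,\,03,\,41^{(2)},\,42^{(2)},\,43^{(2)}$. -/

import Mathlib

namespace Graph

variable {α β : Type*}

/-- The multigraph with vertex type `α` and edge type `β` in which the edge `e` joins the two
(possibly equal) vertices listed in `ends e`. -/
def ofEnds (ends : β → α × α) : Graph α β where
  vertexSet := Set.univ
  IsLink e x y := ends e = (x, y) ∨ ends e = (y, x)
  isLink_symm _ _ := ⟨fun _ _ h ↦ h.symm⟩
  eq_or_eq_of_isLink_of_isLink := by
    rintro e x y v w h h'
    grind
  left_mem_of_isLink _ _ _ _ := Set.mem_univ _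

/-- `C` is the edge set of a cycle of the multigraph `G`: there are `k + 1 ≥ 1` distinct vertices
`v 0, …, v k` and distinct edges `e 0, …, e k` such that `e i` joins `v i` to `v (i + 1)` (indices
modulo `k + 1`). A loop is a cycle with one edge, two parallel edges form a cycle with two edges. -/
def IsCycleSet (G : Graph α β) (C : Set β) : Prop :=
  ∃ (k : ℕ) (v : Fin (k + 1) → α) (e : Fin (k + 1) → β),
    Function.Injective v ∧ Function.Injective e ∧
    (∀ i, G.IsLink (e i) (v i) (v (i + 1))) ∧ C = Set.range e

/-- A set of edges of `G` that contains no cycle. -/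
def IsAcyclicSet (G : Graph α β) (I : Set β) : Prop :=
  I ⊆ G.edgeSet ∧ ∀ C ⊆ I, ¬ G.IsCycleSet C

open Classical in
/-- The column of the vertex-edge incidence matrix of `G` over `GF(2)` (auxiliary: it is used only
to prove the matroid axioms below). -/
noncomputable def incVec (G : Graph α β) (e : β) : α →₀ ZMod 2 :=
  if h : ∃ p : α × α, G.IsLink e p.1 p.2 then
    Finsupp.single h.choose.1 1 + Finsupp.single h.choose.2 1 else 0

lemma incVec_eq (G : Graph α β) {e : β} {x y : α} (h : G.IsLink e x y) :
    G.incVec e = Finsupp.single x 1 + Finsupp.single y 1 := by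
  have hex : ∃ p : α × α, G.IsLink e p.1 p.2 := ⟨(x, y), h⟩
  rw [incVec, dif_pos hex]
  have hc := hex.choose_spec
  generalize hex.choose = p at hc ⊢
  obtain ⟨a, b⟩ := p
  change G.IsLink e a b at hc
  change Finsupp.single a 1 + Finsupp.single b 1 = _
  rcases G.eq_or_eq_of_isLink_of_isLink hc h with rfl | rfl
  · rcases G.eq_or_eq_of_isLink_of_isLink hc.symm h with rfl | rfl
    · rcases G.eq_or_eq_of_isLink_of_isLink h.symm hc with rfl | rfl <;> rfl
    · rfl
  · rcases G.eq_or_eq_of_isLink_of_isLink hc.symm h with rfl | rfl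
    · exact add_comm _ _
    · rcases G.eq_or_eq_of_isLink_of_isLink h hc with rfl | rfl <;> rfl

lemma not_linearIndepOn_of_isCycleSet (G : Graph α β) {C : Set β} (hC : G.IsCycleSet C) :
    ¬ LinearIndepOn (ZMod 2) G.incVec C := by
  classical
  obtain ⟨k, v, e, -, he, hl, rfl⟩ := hC
  intro h
  have h' : LinearIndependent (ZMod 2) (fun i ↦ G.incVec (e i)) := by
    have := (linearIndepOn_range_iff he G.incVec).1 h
    exact this
  rw [Fintype.linearIndependent_iff] at h'
  have hsum : ∑ i, (1 : ZMod 2) • G.incVec (e i) = 0 := by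
    simp_rw [one_smul, fun i ↦ G.incVec_eq (hl i), Finset.sum_add_distrib]
    have hshift : ∑ i, (Finsupp.single (v (i + 1)) 1 : α →₀ ZMod 2) =
        ∑ i, Finsupp.single (v i) 1 :=
      Equiv.sum_comp (Equiv.addRight (1 : Fin (k + 1))) (fun i ↦ Finsupp.single (v i) 1)
    rw [hshift]
    ext x
    simp only [Finsupp.add_apply, Finsupp.zero_apply]
    exact CharTwo.add_self_eq_zero _
  exact one_ne_zero (h' (fun _ ↦ 1) hsum 0)

/-- A closed stretch of a non-backtracking walk without loops that repeats no vertex is a cycle. -/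
lemma exists_isCycleSet_of_walk (G : Graph α β) {F : Set β} {v : ℕ → α} {e : ℕ → β}
    (hF : ∀ n, e n ∈ F) (hl : ∀ n, G.IsLink (e n) (v n) (v (n + 1)))
    (hne : ∀ n, v n ≠ v (n + 1)) (hb : ∀ n, e n ≠ e (n + 1))
    (hrep : ∃ j i, i < j ∧ v i = v j) : ∃ C ⊆ F, G.IsCycleSet C := by
  classical
  set j := Nat.find hrep with hj
  obtain ⟨i, hij, hv⟩ : ∃ i, i < j ∧ v i = v j := Nat.find_spec hrep
  have hmin : ∀ b < j, ∀ a < b, v a ≠ v b := fun b hbj a hab hab' ↦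
    Nat.find_min hrep hbj ⟨a, hab, hab'⟩
  obtain ⟨k, hk⟩ : ∃ k, j = i + k + 1 := ⟨j - i - 1, by omega⟩
  have hinj : ∀ a b : ℕ, a < j → b < j → v a = v b → a = b := by
    intro a b ha hb' hab
    rcases lt_trichotomy a b with h | h | h
    · exact absurd hab (hmin b hb' a h)
    · exact h
    · exact absurd hab.symm (hmin a ha b h)
  have hedge : ∀ a b : ℕ, i ≤ a → a < b → b < j → e a ≠ e b := by
    intro a b hia hab hbj heq
    have hla := hl a
    rw [heq] at hla
    have h1 := G.eq_or_eq_of_isLink_of_isLink hla (hl b)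
    have h2 := G.eq_or_eq_of_isLink_of_isLink hla.symm (hl b)
    have hvab : v a ≠ v b := hmin b hbj a hab
    have h1' : v a = v (b + 1) := h1.resolve_left hvab
    have hbj' : b + 1 = j := by
      by_contra hne'
      have := hinj a (b + 1) (by omega) (by omega) h1'
      omega
    rw [hbj', ← hv] at h1'
    have hai : a = i := hinj a i (by omega) hij h1'
    rcases h2 with h2 | h2
    · have : a + 1 = b := hinj _ _ (by omega) hbj h2
      subst this
      exact hb a heq
    · rw [hbj', ← hv, hai] at h2
      exact hne i h2.symm
  refine ⟨Set.range (fun t : Fin (k + 1) ↦ e (i + t)), ?_, k, fun t ↦ v (i + t),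
    fun t ↦ e (i + t), ?_, ?_, ?_, rfl⟩
  · rintro _ ⟨t, rfl⟩
    exact hF _
  · intro s t hst
    have := hinj (i + s) (i + t) (by omega) (by omega) hst
    exact Fin.ext (by omega)
  · intro s t hst
    rcases lt_trichotomy s t with h | h | h
    · exact absurd hst (hedge (i + s) (i + t) (by omega) (by have := Fin.lt_def.1 h; omega)
        (by omega))
    · exact h
    · exact absurd hst.symm (hedge (i + t) (i + s) (by omega)
        (by have := Fin.lt_def.1 h; omega) (by omega))
  · intro t
    by_cases ht : t = Fin.last k
    · subst ht
      have := hl (i + k)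
      rw [← hk, ← hv] at this
      simpa using this
    · have hlt : t < Fin.last k := Fin.lt_last_iff_ne_last.2 ht
      have := hl (i + t)
      simp only [Fin.val_add_one_of_lt hlt]
      exact this

lemma exists_isCycleSet_of_not_linearIndepOn (G : Graph α β) {I : Set β} (hIE : I ⊆ G.edgeSet)
    (hI : ¬ LinearIndepOn (ZMod 2) G.incVec I) : ∃ C ⊆ I, G.IsCycleSet C := by
  classical
  by_cases hloop : ∃ e ∈ I, ∃ x, G.IsLink e x x
  · obtain ⟨e, heI, x, hx⟩ := hloop
    exact ⟨{e}, by simpa using heI, 0, fun _ ↦ x, fun _ ↦ e,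
      fun _ _ _ ↦ Fin.ext (by omega), fun _ _ _ ↦ Fin.ext (by omega),
      fun _ ↦ hx, by simp⟩
  push Not at hloop
  rw [linearIndepOn_iff'] at hI
  push Not at hI
  obtain ⟨t, g, htI, hsum, e₀, he₀, hg₀⟩ := hI
  set F := t.filter (fun e ↦ g e ≠ 0) with hF
  have hFI : ∀ e ∈ F, e ∈ I := fun e he ↦ htI (Finset.mem_filter.1 he).1
  have hone : ∀ a : ZMod 2, a ≠ 0 → a = 1 := by decide
  have hsumF : ∑ e ∈ F, G.incVec e = 0 := by
    rw [← hsum, hF, Finset.sum_filter]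
    refine Finset.sum_congr rfl fun e _ ↦ ?_
    by_cases h : g e = 0
    · simp [h]
    · simp [hone _ h]
  -- a vertex at the end of an edge of `F` meets another edge of `F`
  have hnext : ∀ e ∈ F, ∀ x y, G.IsLink e x y → ∃ e' ∈ F, e' ≠ e ∧ ∃ z, G.IsLink e' y z := by
    intro e he x y hxy
    by_contra! hcon
    have hval : (∑ e' ∈ F, G.incVec e') y = 1 := by
      rw [Finsupp.finsetSum_apply, Finset.sum_eq_single_of_mem e he]
      · rw [G.incVec_eq hxy]
        have hxy' : x ≠ y := fun h ↦ hloop e (hFI e he) y (h ▸ hxy)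
        simp [hxy']
      · intro e' he' hne
        obtain ⟨a, b, hab⟩ := G.exists_isLink_of_mem_edgeSet (hIE (hFI e' he'))
        have ha : a ≠ y := fun h ↦ hcon e' he' hne b (h ▸ hab)
        have hb : b ≠ y := fun h ↦ hcon e' he' hne a (h ▸ hab.symm)
        rw [G.incVec_eq hab]
        simp [ha, hb]
    rw [hsumF] at hval
    simp at hval
  -- the non-backtracking walk, as an iteration on darts
  let D := {d : β × α × α // d.1 ∈ F ∧ G.IsLink d.1 d.2.1 d.2.2}
  have hstep : ∀ d : D, ∃ d' : D, d'.1.1 ≠ d.1.1 ∧ d'.1.2.1 = d.1.2.2 := by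
    rintro ⟨⟨e, x, y⟩, he, hxy⟩
    obtain ⟨e', he', hne, z, hz⟩ := hnext e he x y hxy
    exact ⟨⟨⟨e', y, z⟩, he', hz⟩, hne, rfl⟩
  choose nxt hnxt1 hnxt2 using hstep
  have he₀F : e₀ ∈ F := Finset.mem_filter.2 ⟨he₀, hg₀⟩
  obtain ⟨x₀, y₀, h₀⟩ := G.exists_isLink_of_mem_edgeSet (hIE (hFI e₀ he₀F))
  let w : ℕ → D := fun n ↦ nxt^[n] ⟨⟨e₀, x₀, y₀⟩, he₀F, h₀⟩
  have hw : ∀ n, w (n + 1) = nxt (w n) := fun n ↦ Function.iterate_succ_apply' _ _ _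
  have hlink : ∀ n, G.IsLink (w n).1.1 (w n).1.2.1 (w (n + 1)).1.2.1 := by
    intro n
    rw [hw, hnxt2]
    exact (w n).2.2
  refine G.exists_isCycleSet_of_walk (v := fun n ↦ (w n).1.2.1) (e := fun n ↦ (w n).1.1)
    (fun n ↦ hFI _ (w n).2.1) hlink ?_ ?_ ?_
  · intro n h
    have := hlink n
    rw [← show (w n).1.2.1 = (w (n + 1)).1.2.1 from h] at this
    exact hloop _ (hFI _ (w n).2.1) _ this
  · intro n h
    have h' : (w n).1.1 = (w (n + 1)).1.1 := h
    rw [hw] at h'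
    exact hnxt1 _ h'.symm
  · -- two steps with the same edge share an end, so some vertex repeats
    have hfin : (F : Set β).Finite := F.finite_toSet
    have hVfin : {x | ∃ e ∈ F, ∃ y, G.IsLink e x y}.Finite := by
      have hsub : {x | ∃ e ∈ F, ∃ y, G.IsLink e x y} ⊆
          ⋃ e ∈ (F : Set β), {x | ∃ y, G.IsLink e x y} := by
        rintro x ⟨e, he, y, h⟩
        simp only [Set.mem_iUnion]
        exact ⟨e, he, y, h⟩
      refine (hfin.biUnion fun e he ↦ ?_).subset hsub
      obtain ⟨a, b, hab⟩ := G.exists_isLink_of_mem_edgeSet (hIE (hFI e he))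
      refine (Set.toFinite {a, b}).subset ?_
      rintro x ⟨y, hxy⟩
      exact G.eq_or_eq_of_isLink_of_isLink hxy hab
    obtain ⟨a, -, b, -, hab, hv⟩ := Set.infinite_univ.exists_ne_map_eq_of_mapsTo
      (f := fun n ↦ (w n).1.2.1) (t := {x | ∃ e ∈ F, ∃ y, G.IsLink e x y})
      (fun n _ ↦ ⟨_, (w n).2.1, _, (w n).2.2⟩) hVfin
    rcases lt_or_gt_of_ne hab with h | h
    · exact ⟨b, a, h, hv⟩
    · exact ⟨a, b, h, hv.symm⟩

lemma isAcyclicSet_iff (G : Graph α β) {I : Set β} :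
    G.IsAcyclicSet I ↔ I ⊆ G.edgeSet ∧ LinearIndepOn (ZMod 2) G.incVec I := by
  refine and_congr_right fun hIE ↦ ⟨fun h ↦ ?_, fun h C hCI hC ↦ ?_⟩
  · by_contra hI
    obtain ⟨C, hCI, hC⟩ := G.exists_isCycleSet_of_not_linearIndepOn hIE hI
    exact h C hCI hC
  · exact G.not_linearIndepOn_of_isCycleSet hC (h.mono hCI)

/-- The cycle matroid `M(G)` of a multigraph `G`: its ground set is the edge set of `G`, and a set
of edges is independent if and only if it contains no cycle of `G`. -/
def cycleMatroid (G : Graph α β) : Matroid β :=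
  (IndepMatroid.ofFinitaryCardAugment (E := G.edgeSet) (Indep := G.IsAcyclicSet)
    (indep_empty := by
      refine ⟨Set.empty_subset _, ?_⟩
      rintro _ hC ⟨k, v, e, -, -, -, rfl⟩
      exact hC ⟨0, rfl⟩)
    (indep_subset := fun I J hJ hIJ ↦ ⟨hIJ.trans hJ.1, fun C hC ↦ hJ.2 C (hC.trans hIJ)⟩)
    (indep_aug := by
      intro I J hI hIfin hJ hJfin hlt
      rw [isAcyclicSet_iff] at hI hJ
      by_contra! hcon
      have hspan : ∀ e ∈ J, G.incVec e ∈ Submodule.span (ZMod 2) (G.incVec '' I) := by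
        intro e he
        by_cases heI : e ∈ I
        · exact Submodule.subset_span ⟨e, heI, rfl⟩
        · by_contra hns
          exact hcon e he heI (G.isAcyclicSet_iff.2
            ⟨Set.insert_subset (hJ.1 he) hI.1, hI.2.insert hns⟩)
      classical
      have := hIfin.fintype
      have := hJfin.fintype
      have := (hIfin.image G.incVec).fintype
      have hle := linearIndependent_le_span_aux' (fun e : J ↦ G.incVec e) hJ.2
        (G.incVec '' I) (by rintro _ ⟨e, rfl⟩; exact hspan e e.2)
      have h2 : Fintype.card (G.incVec '' I) ≤ Fintype.card I :=
        Fintype.card_le_of_surjective (fun e : I ↦ (⟨G.incVec e, e, e.2, rfl⟩ : G.incVec '' I))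
          (by rintro ⟨_, e, he, rfl⟩; exact ⟨⟨e, he⟩, rfl⟩)
      rw [← Nat.card_coe_set_eq I, ← Nat.card_coe_set_eq J, Nat.card_eq_fintype_card,
        Nat.card_eq_fintype_card] at hlt
      omega)
    (indep_compact := by
      refine fun I h ↦ ⟨fun e he ↦ ?_, fun C hCI hC ↦ ?_⟩
      · exact (h {e} (by simpa using he) (Set.finite_singleton e)).1 rfl
      · have hfin : C.Finite := by
          obtain ⟨k, v, e, -, -, -, rfl⟩ := hC
          exact Set.finite_range e
        exact (h C hCI hfin).2 C subset_rfl hC)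
    (subset_ground := fun _ hI ↦ hI.1)).matroid

@[simp] lemma cycleMatroid_ground (G : Graph α β) : G.cycleMatroid.E = G.edgeSet := rfl

@[simp] lemma cycleMatroid_indep (G : Graph α β) (I : Set β) :
    G.cycleMatroid.Indep I ↔ I ⊆ G.edgeSet ∧ ∀ C ⊆ I, ¬ G.IsCycleSet C := Iff.rfl

/-- A 4-cycle with three of its edges doubled. -/
def L₁ : Graph (Fin 4) (Fin 7) :=
  ofEnds ![(0, 1), (0, 1), (1, 2), (1, 2), (2, 3), (2, 3), (3, 0)]

/-- A path `1, 2, 3` together with a vertex `0` joined to each of `1, 2, 3` by two edges. -/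
def L₂ : Graph (Fin 4) (Fin 8) :=
  ofEnds ![(0, 1), (0, 1), (0, 2), (0, 2), (0, 3), (0, 3), (1, 2), (2, 3)]

/-- A triangle `0, 1, 2` with a vertex `3` joined by two edges to `0` and by one edge to `2`, and
a vertex `4` joined by two edges to `1` and by one edge to `2`. -/
def L₃ : Graph (Fin 5) (Fin 9) :=
  ofEnds ![(0, 1), (1, 2), (0, 2), (0, 3), (0, 3), (3, 2), (1, 4), (1, 4), (4, 2)]

/-- A 4-cycle `0, 1, 2, 3` with a vertex `4` joined by two edges to `0` and by one edge to the
opposite vertex `2`, and a vertex `5` joined by two edges to `1` and by one edge to the opposite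
vertex `3`. -/
def L₄ : Graph (Fin 6) (Fin 10) :=
  ofEnds ![(0, 1), (1, 2), (2, 3), (3, 0), (0, 4), (0, 4), (4, 2), (1, 5), (1, 5), (5, 3)]

/-- Two vertices `0` and `4`, and three vertices `1, 2, 3` each of which is joined to `0` by one
edge and to `4` by two edges. -/
def L₅ : Graph (Fin 5) (Fin 9) :=
  ofEnds ![(0, 1), (0, 2), (0, 3), (4, 1), (4, 1), (4, 2), (4, 2), (4, 3), (4, 3)]

end Graph

namespace Matroid

variable {α β : Type*}

/-- `M` is connected: any two distinct elements lie in a common circuit. -/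
def IsConnected (M : Matroid α) : Prop :=
  ∀ ⦃e f⦄, e ∈ M.E → f ∈ M.E → e ≠ f → ∃ C, M.IsCircuit C ∧ e ∈ C ∧ f ∈ C

/-- `M` is binary: it is the vector matroid of a matrix over `GF(2)`; `v e` is the column
of the element `e`. -/
def IsBinary (M : Matroid α) : Prop :=
  ∃ (n : ℕ) (v : α → (Fin n → ZMod 2)), ∀ I ⊆ M.E, M.Indep I ↔ LinearIndepOn (ZMod 2) v I

open scoped Function in
/-- `M` has `k` skew circuits: circuits `C₁, …, C_k` such that the restriction of `M` to their
union is the direct sum of the restrictions `M|C₁, …, M|C_k`. (The ground sets of the summands of a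
direct sum are disjoint; as circuits are non-empty, the circuits are then distinct.) -/
def HasSkewCircuits (M : Matroid α) (k : ℕ) : Prop :=
  ∃ C : Fin k → Set α, (∀ i, M.IsCircuit (C i)) ∧
    ∃ h : Pairwise (Disjoint on fun i ↦ (M ↾ C i).E),
      M ↾ (⋃ i, C i) = Matroid.disjointSigma (fun i ↦ M ↾ C i) h

/-- `N` is obtained from `M` by deleting one element, or by contracting one element that lies in
a 2-element cocircuit. -/
def IsSeriesStep (M N : Matroid α) : Prop :=
  (∃ e ∈ M.E, N = M.delete {e}) ∨
    (∃ e f, e ≠ f ∧ M.IsCocircuit {e, f} ∧ N = M.contract {e})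

/-- `N` is a series minor of `M`: it is obtained from `M` by a (possibly empty) sequence of
deletions and series contractions. -/
def IsSeriesMinor (N M : Matroid α) : Prop :=
  Relation.ReflTransGen IsSeriesStep M N

/-- `M` and `N` are isomorphic. -/
def IsIsomorphic (M : Matroid α) (N : Matroid β) : Prop :=
  ∃ φ : M.E ≃ N.E, ∀ I : Set M.E,
    M.Indep (Subtype.val '' I) ↔ N.Indep (Subtype.val '' (φ '' I))

end Matroid

/-! ### Representing the dual over GF(2): deletion, change of basis and series contraction -/

namespace Matroid

variable {α β : Type*} {d : ℕ}

/-! A basis of the cycle space of a binary matroid gives each element a coordinate vector, and these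
vectors represent the dual (`IsCorep`). Elements with equal nonzero vectors are in series, so after
series contractions only the set of vectors matters (`IsCorep.exists_isIsomorphic`). It therefore
suffices to find a restriction whose cycle space has a basis of four or five circuits with a
controlled set of vectors.

Let `a`, `b`, `c` be the skew circuits. By connectedness some circuit meets `a ∪ b` and `c`; choose
such a circuit `d` with as few elements as possible outside `a ∪ b ∪ c`. Minimality makes `d` raise
the dimension of the cycle space by only one (`exists_connecting`). If `d` meets all three circuits,
the vectors are exactly those of `L₁`. Otherwise, by symmetry, `d` meets `a` and `c` but not `b`,
and a second circuit `d'`, minimal in the same sense, connects `a ∪ c ∪ d` to `b`.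

Now `d` cuts `a ∪ c ∪ d` into five parts, and the vectors are determined by whether `d'` avoids,
contains or cuts each part: at most `3 ^ 5` configurations. As `d'` is elementary, it does not agree
on `a ∪ c ∪ d` with any combination of `a`, `c`, `d`. Changes of basis act on the configurations,
and a finite check (`exists_applyWord`) brings each remaining one to a form in which either a
deletion yields `L₁` or the vectors are those of `L₂`, `L₃`, `L₄` or `L₅`. -/

lemma zmod_two_eq_one {a : ZMod 2} (ha : a ≠ 0) : a = 1 := by
  revert a; decide

/-- The vectors `f e` over `GF(2)` represent the dual of `M`: a set is independent in `M` if and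
only if the vectors of the elements outside it span. -/
def IsCorep (M : Matroid α) (f : α → Fin d → ZMod 2) : Prop :=
  ∀ I ⊆ M.E, M.Indep I ↔ ∀ y : Fin d → ZMod 2, (∀ e ∈ M.E, e ∉ I → f e ⬝ᵥ y = 0) → y = 0

lemma IsCorep.eq_zero {M : Matroid α} {f : α → Fin d → ZMod 2} (h : M.IsCorep f)
    {y : Fin d → ZMod 2} (hy : ∀ e ∈ M.E, f e ⬝ᵥ y = 0) : y = 0 :=
  (h ∅ (Set.empty_subset _)).1 M.empty_indep y fun e he _ ↦ hy e he

/-- Deletion restricts the functionals to a subspace, which is parametrized by `B`. -/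
lemma IsCorep.restrict {d' : ℕ} {M : Matroid α} {f : α → Fin d → ZMod 2} (h : M.IsCorep f)
    {Y : Set α} (hY : Y ⊆ M.E) {f' : α → Fin d' → ZMod 2} (B : (Fin d' → ZMod 2) → Fin d → ZMod 2)
    (hB0 : ∀ y, B y = 0 → y = 0) (hB0' : B 0 = 0) (hBf : ∀ e ∈ Y, ∀ y, f e ⬝ᵥ B y = f' e ⬝ᵥ y)
    (hBz : ∀ e ∈ M.E, e ∉ Y → ∀ y, f e ⬝ᵥ B y = 0)
    (hBr : ∀ y, (∀ e ∈ M.E, e ∉ Y → f e ⬝ᵥ y = 0) → ∃ y', B y' = y) : (M ↾ Y).IsCorep f' := by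
  intro I hI
  replace hI : I ⊆ Y := hI
  rw [restrict_indep_iff, and_iff_left hI, h I (hI.trans hY)]
  refine ⟨fun H y hy ↦ hB0 _ (H _ fun e he heI ↦ ?_), fun H y hy ↦ ?_⟩
  · by_cases heY : e ∈ Y
    · rw [hBf e heY]
      exact hy e heY heI
    · exact hBz e he heY y
  · obtain ⟨y, rfl⟩ := hBr y fun e he heY ↦ hy e he fun heI ↦ heY (hI heI)
    rw [H y, hB0']
    intro e he heI
    have := hy e (hY he) heI
    rwa [hBf e he] at this

/-- Change of basis. -/
lemma IsCorep.mulVec {M : Matroid α} {f : α → Fin d → ZMod 2} (h : M.IsCorep f)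
    {A A' : Matrix (Fin d) (Fin d) (ZMod 2)} (hA : A' * A = 1) :
    M.IsCorep fun e ↦ A.mulVec (f e) := by
  have hA' : A * A' = 1 := mul_eq_one_comm.1 hA
  have key : ∀ e y, A.mulVec (f e) ⬝ᵥ y = f e ⬝ᵥ A.transpose.mulVec y := by
    intro e y
    rw [Matrix.mulVec_transpose, dotProduct_comm, Matrix.dotProduct_mulVec, dotProduct_comm]
  have h1 : A'.transpose * A.transpose = 1 := by
    rw [← Matrix.transpose_mul, hA', Matrix.transpose_one]
  have h2 : A.transpose * A'.transpose = 1 := by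
    rw [← Matrix.transpose_mul, hA, Matrix.transpose_one]
  intro I hI
  rw [h I hI]
  simp only [key]
  refine ⟨fun H y hy ↦ ?_, fun H y hy ↦ ?_⟩
  · have := congrArg A'.transpose.mulVec (H _ hy)
    rwa [Matrix.mulVec_mulVec, h1, Matrix.one_mulVec, Matrix.mulVec_zero] at this
  · have hy2 := H (A'.transpose.mulVec y) (by
      intro e he heI
      rw [Matrix.mulVec_mulVec, h2, Matrix.one_mulVec]
      exact hy e he heI)
    have := congrArg A.transpose.mulVec hy2
    rwa [Matrix.mulVec_mulVec, h2, Matrix.one_mulVec, Matrix.mulVec_zero] at this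

lemma IsCorep.isIsomorphic {M : Matroid α} {N : Matroid β} {f : α → Fin d → ZMod 2}
    {g : β → Fin d → ZMod 2} (hf : M.IsCorep f) (hg : N.IsCorep g) (φ : M.E ≃ N.E)
    (hφ : ∀ e : M.E, f e = g (φ e)) : M.IsIsomorphic N := by
  refine ⟨φ, fun I ↦ ?_⟩
  rw [hf _ (Subtype.coe_image_subset _ _), hg _ (Subtype.coe_image_subset _ _)]
  refine forall_congr' fun y ↦ ?_
  have : (∀ e ∈ M.E, e ∉ Subtype.val '' I → f e ⬝ᵥ y = 0) ↔
      ∀ e ∈ N.E, e ∉ Subtype.val '' (φ '' I) → g e ⬝ᵥ y = 0 := by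
    constructor
    · intro H e he heI
      obtain ⟨e', he'⟩ := φ.surjective ⟨e, he⟩
      have h1 := H e' e'.2 (by
        rintro ⟨x, hx, hxe⟩
        exact heI ⟨φ x, ⟨x, hx, rfl⟩, by rw [Subtype.ext hxe, he']⟩)
      rwa [hφ, he'] at h1
    · intro H e he heI
      have h1 := H (φ ⟨e, he⟩) (φ ⟨e, he⟩).2 (by
        rintro ⟨_, ⟨x, hx, rfl⟩, hxe⟩
        have := φ.injective (Subtype.ext hxe)
        exact heI ⟨x, hx, by rw [this]⟩)
      rwa [← hφ] at h1
  rw [this]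

/-- In the dual, equal vectors are parallel and nonzero vectors are not loops. -/
lemma IsCorep.isCocircuit_pair {M : Matroid α} [M.Finite] {f : α → Fin d → ZMod 2}
    (hf : M.IsCorep f) {e e' : α} (he : e ∈ M.E) (he' : e' ∈ M.E) (hne : e ≠ e')
    (hee' : f e = f e') (h0 : f e ≠ 0) : M.IsCocircuit {e, e'} := by
  classical
  -- Among the cycles `y` through `a`, one with the smallest support `C` is a circuit; a base
  -- containing `C \ {a}` must avoid `a`.
  have hsing : ∀ a ∈ M.E, f a ≠ 0 → M✶.Indep {a} := by
    intro a ha h0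
    have hex : ∃ n : ℕ, ∃ y : Fin d → ZMod 2,
        f a ⬝ᵥ y ≠ 0 ∧ {b ∈ M.E | f b ⬝ᵥ y ≠ 0}.ncard = n := by
      obtain ⟨i, hi⟩ := Function.ne_iff.1 h0
      exact ⟨_, Pi.single i 1, by simpa using hi, rfl⟩
    obtain ⟨y, hy, hyn⟩ := Nat.find_spec hex
    have hmin := fun m hm ↦ Nat.find_min hex (m := m) hm
    rw [← hyn] at hmin
    set C := {b ∈ M.E | f b ⬝ᵥ y ≠ 0} with hC
    have hCE : C ⊆ M.E := Set.sep_subset _ _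
    have hCdep : ¬ M.Indep C := by
      rw [hf C hCE]
      intro H
      have := H y fun b hb hbC ↦ by
        by_contra hcon
        exact hbC ⟨hb, hcon⟩
      exact hy (by simp [this])
    have hind : M.Indep (C \ {a}) := by
      rw [hf _ (Set.sdiff_subset.trans hCE)]
      intro z hz
      by_contra hz0
      have hzs : ∀ b ∈ M.E, f b ⬝ᵥ z ≠ 0 → b ∈ C ∧ b ≠ a := by
        intro b hb hbz
        by_contra hcon
        exact hbz (hz b hb hcon)
      have hza : f a ⬝ᵥ z = 0 := by
        by_contra hcon
        exact (hzs a ha hcon).2 rfl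
      obtain ⟨b, hb, hbz⟩ : ∃ b ∈ M.E, f b ⬝ᵥ z ≠ 0 := by
        by_contra! hcon
        exact hz0 (hf.eq_zero hcon)
      -- A nonzero cycle `z` inside `C \ {a}` would give the cycle `y + z`, which still passes
      -- through `a` but loses the element `b`.
      refine hmin _ ?_ ⟨y + z, by simpa [dotProduct_add, hza] using hy, rfl⟩
      refine Set.ncard_lt_ncard ?_ (M.ground_finite.subset hCE)
      refine ⟨fun x hx ↦ ?_, fun hsub ↦ ?_⟩
      · obtain ⟨hxE, hx⟩ := hx
        by_cases hxz : f x ⬝ᵥ z = 0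
        · exact ⟨hxE, by simpa [dotProduct_add, hxz] using hx⟩
        · exact (hzs x hxE hxz).1
      · have hbC := (hzs b hb hbz).1
        refine (hsub hbC).2 ?_
        rw [dotProduct_add, zmod_two_eq_one hbz, zmod_two_eq_one hbC.2]
        rfl
    obtain ⟨B, hB, hCB⟩ := hind.exists_isBase_superset
    rw [dual_indep_iff_exists']
    refine ⟨by simpa using ha, B, hB, ?_⟩
    rw [Set.disjoint_singleton_left]
    intro haB
    exact hCdep (hB.indep.subset fun x hx ↦ by
      by_cases hxa : x = a
      · exact hxa ▸ haB
      · exact hCB ⟨hx, hxa⟩)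
  rw [isCocircuit_def, isCircuit_iff_dep_forall_sdiff_singleton_indep]
  refine ⟨?_, ?_⟩
  · rw [dep_iff, dual_indep_iff_exists']
    have hsub : {e, e'} ⊆ M.E := by rintro x (rfl | rfl) <;> assumption
    refine ⟨?_, hsub⟩
    rintro ⟨-, B, hB, hdj⟩
    have heB : e ∉ B := fun h ↦ Set.disjoint_left.1 hdj (by simp) h
    have heB' : e' ∉ B := fun h ↦ Set.disjoint_left.1 hdj (by simp) h
    -- A cycle inside `insert e B` vanishes at `e'`, hence also at `e` because the vectors agree, so
    -- it already lies in the independent set `B`.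
    have h1 := hB.insert_dep ⟨he, heB⟩
    have h2 := h1.not_indep
    rw [hf _ h1.subset_ground] at h2
    push Not at h2
    obtain ⟨y, hy, hy0⟩ := h2
    refine hy0 ((hf B hB.subset_ground).1 hB.indep y fun b hb hbB ↦ ?_)
    by_cases hbe : b = e
    · rw [hbe, hee']
      exact hy e' he' (by simp [hne.symm, heB'])
    · exact hy b hb (by simp [hbe, hbB])
  · rintro x (rfl | rfl)
    · rw [Set.pair_sdiff_left hne]
      exact hsing _ he' (hee' ▸ h0)
    · rw [Set.pair_sdiff_right hne]
      exact hsing _ he h0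

/-- Dually this deletes one of two equal vectors: the other copy keeps the span unchanged, so `e` is
not a loop and the remaining vectors still represent. -/
lemma IsCorep.contract_singleton {M : Matroid α} {f : α → Fin d → ZMod 2}
    (hf : M.IsCorep f) {e e' : α} (he : e ∈ M.E) (he' : e' ∈ M.E) (hne : e ≠ e')
    (hee' : f e = f e') : (M.contract {e}).IsCorep f := by
  have hnl : M.IsNonloop e := by
    rw [← indep_singleton, hf _ (by simpa using he)]
    intro y hy
    refine hf.eq_zero fun b hb ↦ ?_
    by_cases hbe : b = e
    · rw [hbe, hee']
      exact hy e' he' hne.symm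
    · exact hy b hb hbe
  intro I hI
  replace hI : I ⊆ M.E \ {e} := hI
  have heI : e ∉ I := fun h ↦ (hI h).2 rfl
  rw [hnl.contractElem_indep_iff, and_iff_right heI,
    hf _ (Set.insert_subset he (hI.trans Set.sdiff_subset))]
  refine forall_congr' fun y ↦ imp_congr_left ⟨fun H b hb hbI ↦ ?_, fun H b hb hbI ↦ ?_⟩
  · exact H b hb.1 (by rintro (h | h); exacts [hb.2 h, hbI h])
  · exact H b ⟨hb, fun h ↦ hbI (Or.inl h)⟩ fun h ↦ hbI (Or.inr h)

lemma IsSeriesMinor.trans {M N K : Matroid α} (h : K.IsSeriesMinor N) (h' : N.IsSeriesMinor M) :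
    K.IsSeriesMinor M :=
  Relation.ReflTransGen.trans h' h

lemma restrict_isSeriesMinor (M : Matroid α) [M.Finite] {Y : Set α} (hY : Y ⊆ M.E) :
    (M ↾ Y).IsSeriesMinor M := by
  have key : ∀ n, ∀ N : Matroid α, N.E.Finite → Y ⊆ N.E → (N.E \ Y).ncard = n →
      (N ↾ Y).IsSeriesMinor N := by
    intro n
    induction n with
    | zero =>
      intro N hN hY h
      rw [Set.ncard_eq_zero (hN.subset Set.sdiff_subset), Set.sdiff_eq_empty] at h
      rw [hY.antisymm h, restrict_ground_eq_self]
      exact Relation.ReflTransGen.refl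
    | succ n ih =>
      intro N hN hY h
      obtain ⟨e, he⟩ : (N.E \ Y).Nonempty := Set.nonempty_of_ncard_ne_zero (by omega)
      have hYe : Y ⊆ N.E \ {e} := fun x hx ↦ ⟨hY hx, fun hxe ↦ he.2 (hxe ▸ hx)⟩
      have h1 := ih (N.delete {e}) (hN.subset Set.sdiff_subset) hYe (by
        have : (N.delete {e}).E \ Y = (N.E \ Y) \ {e} := by
          ext x; simp; tauto
        rw [this, Set.ncard_sdiff_singleton_of_mem he, h]; rfl)
      refine Relation.ReflTransGen.head (Or.inl ⟨e, he.1, rfl⟩) ?_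
      rwa [delete_eq_restrict, restrict_restrict_eq _ hYe] at h1
  exact key _ M M.ground_finite hY rfl

/-- Each element outside `R` has a copy in `R` with the same vector and is contracted against it.
Zero vectors are excluded because they belong to coloops, which lie in no 2-element cocircuit. -/
lemma IsCorep.exists_seriesMinor {M : Matroid α} [M.Finite] {f : α → Fin d → ZMod 2}
    (hf : M.IsCorep f) (h0 : ∀ e ∈ M.E, f e ≠ 0) {R : Set α} (hR : R ⊆ M.E)
    (hfR : f '' M.E ⊆ f '' R) : ∃ N : Matroid α, N.IsSeriesMinor M ∧ N.E = R ∧ N.IsCorep f := by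
  have key : ∀ n, ∀ N : Matroid α, N.E.Finite → R ⊆ N.E → N.E ⊆ M.E → (N.E \ R).ncard = n →
      N.IsCorep f → ∃ N' : Matroid α, N'.IsSeriesMinor N ∧ N'.E = R ∧ N'.IsCorep f := by
    intro n
    induction n with
    | zero =>
      intro N hN hR _ h hf
      rw [Set.ncard_eq_zero (hN.subset Set.sdiff_subset), Set.sdiff_eq_empty] at h
      exact ⟨N, Relation.ReflTransGen.refl, h.antisymm hR, hf⟩
    | succ n ih =>
      intro N hN hR hNM h hf
      obtain ⟨e, he⟩ : (N.E \ R).Nonempty := Set.nonempty_of_ncard_ne_zero (by omega)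
      obtain ⟨e', he'R, hee'⟩ := hfR ⟨e, hNM he.1, rfl⟩
      have hne : e ≠ e' := fun h ↦ he.2 (h ▸ he'R)
      have hRe : R ⊆ N.E \ {e} := fun x hx ↦ ⟨hR hx, fun hxe ↦ he.2 (hxe ▸ hx)⟩
      obtain ⟨N', h1, h2, h3⟩ := ih (N.contract {e}) (hN.subset Set.sdiff_subset) hRe
        (Set.sdiff_subset.trans hNM) (by
          have : (N.contract {e}).E \ R = (N.E \ R) \ {e} := by
            ext x; simp; tauto
          rw [this, Set.ncard_sdiff_singleton_of_mem he, h]; rfl)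
        (hf.contract_singleton he.1 (hR he'R) hne hee'.symm)
      have : N.Finite := ⟨hN⟩
      exact ⟨N', Relation.ReflTransGen.head (Or.inr ⟨e, e', hne,
        hf.isCocircuit_pair he.1 (hR he'R) hne hee'.symm (h0 e (hNM he.1)), rfl⟩) h1, h2, h3⟩
  exact key _ M M.ground_finite hR subset_rfl rfl hf

/-- The target has one element per vector, so keeping one representative of each series class of `M`
produces it. -/
lemma IsCorep.exists_isIsomorphic {k : ℕ} {M : Matroid α} [M.Finite] {f : α → Fin d → ZMod 2}
    (hf : M.IsCorep f) {L : Matroid (Fin k)} (hL : L.E = Set.univ) {g : Fin k → Fin d → ZMod 2}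
    (hg : L.IsCorep g) (hinj : Function.Injective g) (h0 : ∀ i, g i ≠ 0)
    (hfg : f '' M.E = Set.range g) : ∃ N : Matroid α, N.IsSeriesMinor M ∧ N.IsIsomorphic L := by
  have h1 : ∀ i, ∃ e ∈ M.E, f e = g i := fun i ↦ by
    have : g i ∈ f '' M.E := hfg ▸ Set.mem_range_self i
    exact this
  choose r hrE hr using h1
  have hrinj : Function.Injective r := fun i j hij ↦ hinj (by rw [← hr, ← hr, hij])
  obtain ⟨N, hN, hNE, hNf⟩ := hf.exists_seriesMinor (R := Set.range r)
    (fun e he ↦ by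
      have : f e ∈ Set.range g := hfg ▸ Set.mem_image_of_mem f he
      obtain ⟨i, hi⟩ := this
      exact hi ▸ h0 i)
    (by rintro _ ⟨i, rfl⟩; exact hrE i)
    (by
      rw [hfg]
      rintro _ ⟨i, rfl⟩
      exact ⟨r i, ⟨i, rfl⟩, hr i⟩)
  refine ⟨N, hN, ?_⟩
  let ψ : Fin k ≃ Set.range r := Equiv.ofInjective r hrinj
  let φ : N.E ≃ L.E := (Equiv.setCongr hNE).trans (ψ.symm.trans
    ((Equiv.Set.univ (Fin k)).symm.trans (Equiv.setCongr hL.symm)))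
  refine hNf.isIsomorphic hg φ fun e : N.E ↦ ?_
  obtain ⟨i, hi⟩ : ∃ i, r i = e := by
    exact hNE.subset e.2
  have h2 : (φ e : Fin k) = i := by
    have : ψ.symm ⟨e, hNE ▸ e.2⟩ = i := by
      rw [Equiv.symm_apply_eq]
      exact Subtype.ext hi.symm
    exact this
  rw [h2, ← hi, hr]

end Matroid

/-! ### Cycle space coordinates of the five graphs -/

namespace Graph

variable {n k d : ℕ}

/-- The incidence matrix over `GF(2)`. -/
def endsMatrix (ends : Fin k → Fin n × Fin n) : Matrix (Fin n) (Fin k) (ZMod 2) :=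
  fun v e ↦ (if (ends e).1 = v then 1 else 0) + if (ends e).2 = v then 1 else 0

lemma ofEnds_edgeSet (ends : Fin k → Fin n × Fin n) : (ofEnds ends).edgeSet = Set.univ := by
  refine Set.eq_univ_of_forall fun e ↦ ?_
  have : (ofEnds ends).IsLink e (ends e).1 (ends e).2 := Or.inl rfl
  exact this.edge_mem

lemma linearCombination_incVec_eq_zero_iff (ends : Fin k → Fin n × Fin n)
    (l : Fin k →₀ ZMod 2) :
    Finsupp.linearCombination (ZMod 2) (ofEnds ends).incVec l = 0 ↔
      (endsMatrix ends).mulVec l = 0 := by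
  have key : ∀ v : Fin n, Finsupp.linearCombination (ZMod 2) (ofEnds ends).incVec l v =
      (endsMatrix ends).mulVec l v := by
    intro v
    rw [Finsupp.linearCombination_apply, Finsupp.sum_fintype _ _ (by simp),
      Finsupp.finsetSum_apply, Matrix.mulVec, dotProduct]
    refine Finset.sum_congr rfl fun e _ ↦ ?_
    rw [(ofEnds ends).incVec_eq (x := (ends e).1) (y := (ends e).2) (Or.inl rfl)]
    simp [endsMatrix, Finsupp.single_apply, add_mul]
  rw [Finsupp.ext_iff, funext_iff]
  simp [key]

/-- The rows of `g` represent the dual of a cycle matroid if the columns of `g` are a basis of the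
cycle space; `C` and `idx` certify that they span and are independent. -/
lemma isCorep_cycleMatroid {ends : Fin k → Fin n × Fin n} {g : Matrix (Fin k) (Fin d) (ZMod 2)}
    {C : Matrix (Fin k) (Fin n) (ZMod 2)} {idx : Fin d → Fin k} (h1 : endsMatrix ends * g = 0)
    (h2 : g.submatrix idx id = 1)
    (h3 : g * (1 : Matrix (Fin k) (Fin k) (ZMod 2)).submatrix idx id + C * endsMatrix ends = 1) :
    (ofEnds ends).cycleMatroid.IsCorep fun e j ↦ g e j := by
  intro I hI
  rw [cycleMatroid_ground] at hI
  rw [show (ofEnds ends).cycleMatroid.Indep I ↔ (ofEnds ends).IsAcyclicSet I from Iff.rfl,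
    isAcyclicSet_iff, and_iff_right hI, linearIndepOn_iff]
  have hsel : ∀ y, (g.mulVec y) ∘ idx = y := by
    intro y
    have : (g.submatrix idx id).mulVec y = y := by rw [h2, Matrix.one_mulVec]
    exact this
  refine ⟨fun H y hy ↦ ?_, fun H l hl hl0 ↦ ?_⟩
  -- The cycle with coordinates `y` is supported in `I`; its entries at `idx` recover `y`.
  · have := H (Finsupp.equivFunOnFinite.symm (g.mulVec y)) ?_ ?_
    · have h0 : g.mulVec y = 0 := by
        funext e
        exact DFunLike.congr_fun this e
      rw [← hsel y, h0]
      rfl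
    · rw [Finsupp.mem_supported]
      intro e he
      by_contra heI
      exact (Finsupp.mem_support_iff.1 he) (hy e (by simp [ofEnds_edgeSet]) heI)
    · rw [linearCombination_incVec_eq_zero_iff]
      change (endsMatrix ends).mulVec (g.mulVec y) = 0
      rw [Matrix.mulVec_mulVec, h1, Matrix.zero_mulVec]
  · rw [linearCombination_incVec_eq_zero_iff] at hl0
    -- On a cycle `l` the term with `C` in `h3` vanishes, so `l` is the combination of the columns
    -- of `g` with coefficients read off at `idx`.
    have hgl : g.mulVec (l ∘ idx) = l := by
      have h4 := congrArg (fun A ↦ A.mulVec l) h3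
      simp only [Matrix.add_mulVec, ← Matrix.mulVec_mulVec, hl0, Matrix.mulVec_zero, add_zero,
        Matrix.one_mulVec] at h4
      have h5 : ((1 : Matrix (Fin k) (Fin k) (ZMod 2)).submatrix idx id).mulVec l = l ∘ idx := by
        funext i
        simp [Matrix.mulVec, dotProduct, Matrix.one_apply]
      rwa [h5] at h4
    have := H (l ∘ idx) fun e _ heI ↦ by
      have h5 := congrFun hgl e
      refine h5.trans ?_
      by_contra hcon
      exact heI (hl (Finsupp.mem_support_iff.2 hcon))
    rw [this, Matrix.mulVec_zero] at hgl
    ext e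
    exact (congrFun hgl e).symm

/-- Coordinates of the edges of `L₁` with respect to a basis of its cycle space. -/
def coords₁ : Fin 7 → Fin 4 → ZMod 2 :=
  ![![1, 0, 0, 0], ![1, 0, 0, 1], ![0, 1, 0, 0], ![0, 1, 0, 1], ![0, 0, 1, 0], ![0, 0, 1, 1],
    ![0, 0, 0, 1]]

lemma isCorep_L₁ : L₁.cycleMatroid.IsCorep coords₁ :=
  -- `idx` lists edges whose coordinate vectors are the unit vectors. The basis consists of the
  -- three digons and a 4-cycle through one edge of each.
  isCorep_cycleMatroid (g := coords₁) (idx := ![0, 2, 4, 6])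
    (C := ![![0, 0, 0, 0], ![0, 1, 1, 1], ![0, 0, 0, 0], ![0, 0, 1, 1], ![0, 0, 0, 0],
      ![0, 0, 0, 1], ![0, 0, 0, 0]])
    (by decide +kernel) (by decide +kernel) (by decide +kernel)

/-- Coordinates of the edges of `L₂` with respect to a basis of its cycle space. -/
def coords₂ : Fin 8 → Fin 5 → ZMod 2 :=
  -- Here and for `L₃`, `L₄`, `L₅`, columns 0, 1 and 3 are the skew circuits `a`, `c`, `b`, and
  -- columns 2 and 4 are the connecting circuits `d`, `d'`.
  ![![1, 0, 0, 0, 0], ![1, 0, 1, 0, 0], ![0, 1, 0, 0, 0], ![0, 1, 1, 0, 1], ![0, 0, 0, 1, 0],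
    ![0, 0, 0, 1, 1], ![0, 0, 1, 0, 0], ![0, 0, 0, 0, 1]]

lemma isCorep_L₂ : L₂.cycleMatroid.IsCorep coords₂ :=
  isCorep_cycleMatroid (g := coords₂) (idx := ![0, 2, 6, 4, 7])
    (C := ![![0, 0, 0, 0], ![0, 1, 0, 0], ![0, 0, 0, 0], ![0, 0, 1, 0], ![0, 0, 0, 0],
      ![0, 0, 0, 1], ![0, 0, 0, 0], ![0, 0, 0, 0]])
    (by decide +kernel) (by decide +kernel) (by decide +kernel)

/-- Coordinates of the edges of `L₃` with respect to a basis of its cycle space. -/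
def coords₃ : Fin 9 → Fin 5 → ZMod 2 :=
  ![![0, 1, 1, 0, 0], ![0, 1, 0, 0, 0], ![0, 1, 1, 0, 1], ![0, 0, 0, 1, 0], ![0, 0, 0, 1, 1],
    ![0, 0, 0, 0, 1], ![1, 0, 0, 0, 0], ![1, 0, 1, 0, 0], ![0, 0, 1, 0, 0]]

lemma isCorep_L₃ : L₃.cycleMatroid.IsCorep coords₃ :=
  isCorep_cycleMatroid (g := coords₃) (idx := ![6, 1, 8, 3, 5])
    (C := ![![0, 1, 0, 0, 1], ![0, 0, 0, 0, 0], ![0, 0, 1, 0, 0], ![0, 0, 0, 0, 0],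
      ![0, 0, 0, 1, 0], ![0, 0, 0, 0, 0], ![0, 0, 0, 0, 0], ![0, 0, 0, 0, 1], ![0, 0, 0, 0, 0]])
    (by decide +kernel) (by decide +kernel) (by decide +kernel)

/-- Coordinates of the edges of `L₄` with respect to a basis of its cycle space. -/
def coords₄ : Fin 10 → Fin 5 → ZMod 2 :=
  ![![0, 1, 0, 0, 0], ![0, 1, 1, 0, 0], ![0, 1, 1, 0, 1], ![0, 1, 0, 0, 1], ![0, 0, 0, 1, 0],
    ![0, 0, 0, 1, 1], ![0, 0, 0, 0, 1], ![1, 0, 0, 0, 0], ![1, 0, 1, 0, 0], ![0, 0, 1, 0, 0]]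

lemma isCorep_L₄ : L₄.cycleMatroid.IsCorep coords₄ :=
  isCorep_cycleMatroid (g := coords₄) (idx := ![7, 0, 9, 4, 6])
    (C := ![![0, 0, 0, 0, 0, 0], ![0, 1, 0, 0, 0, 1], ![0, 1, 1, 0, 0, 1], ![0, 1, 1, 1, 0, 1],
      ![0, 0, 0, 0, 0, 0], ![0, 0, 0, 0, 1, 0], ![0, 0, 0, 0, 0, 0], ![0, 0, 0, 0, 0, 0],
      ![0, 0, 0, 0, 0, 1], ![0, 0, 0, 0, 0, 0]])
    (by decide +kernel) (by decide +kernel) (by decide +kernel)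

/-- Coordinates of the edges of `L₅` with respect to a basis of its cycle space. -/
def coords₅ : Fin 9 → Fin 5 → ZMod 2 :=
  ![![0, 0, 1, 0, 0], ![0, 0, 0, 0, 1], ![0, 0, 1, 0, 1], ![1, 0, 0, 0, 0], ![1, 0, 1, 0, 0],
    ![0, 0, 0, 1, 0], ![0, 0, 0, 1, 1], ![0, 1, 0, 0, 0], ![0, 1, 1, 0, 1]]

lemma isCorep_L₅ : L₅.cycleMatroid.IsCorep coords₅ :=
  isCorep_cycleMatroid (g := coords₅) (idx := ![3, 7, 0, 5, 1])
    (C := ![![0, 0, 0, 0, 0], ![0, 0, 0, 0, 0], ![0, 1, 1, 1, 1], ![0, 0, 0, 0, 0],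
      ![0, 1, 0, 0, 0], ![0, 0, 0, 0, 0], ![0, 0, 1, 0, 0], ![0, 0, 0, 0, 0], ![0, 1, 1, 0, 1]])
    (by decide +kernel) (by decide +kernel) (by decide +kernel)

end Graph

/-! ### Configurations of two connecting circuits and their finite classification -/

namespace Matroid

variable {α : Type*}

open Graph in
/-- `M` has a series minor isomorphic to one of the matroids `M(L₁), …, M(L₅)`. -/
def HasUnavoidableMinor (M : Matroid α) : Prop :=
  ∃ N : Matroid α, N.IsSeriesMinor M ∧
    (N.IsIsomorphic L₁.cycleMatroid ∨ N.IsIsomorphic L₂.cycleMatroid ∨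
      N.IsIsomorphic L₃.cycleMatroid ∨ N.IsIsomorphic L₄.cycleMatroid ∨
      N.IsIsomorphic L₅.cycleMatroid)

lemma HasUnavoidableMinor.mono {M N : Matroid α} (h : N.HasUnavoidableMinor)
    (hN : N.IsSeriesMinor M) : M.HasUnavoidableMinor := by
  obtain ⟨K, hK, hK'⟩ := h
  exact ⟨K, hK.trans hN, hK'⟩

lemma IsCorep.hasUnavoidableMinor_L₁ {M : Matroid α} [M.Finite] {f : α → Fin 4 → ZMod 2}
    (hf : M.IsCorep f) (h : f '' M.E = Set.range Graph.coords₁) : M.HasUnavoidableMinor := by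
  obtain ⟨N, hN, hi⟩ := hf.exists_isIsomorphic (Graph.ofEnds_edgeSet _) Graph.isCorep_L₁
    (by decide +kernel) (by decide +kernel) h
  exact ⟨N, hN, Or.inl hi⟩

/-- The coordinates of the two parts into which a circuit meeting two skew circuits cuts each of
them, and of the part of that circuit outside both. -/
def partVec : Fin 5 → Fin 5 → ZMod 2 :=
  ![![1, 0, 0, 0, 0], ![1, 0, 1, 0, 0], ![0, 1, 0, 0, 0], ![0, 1, 1, 0, 0], ![0, 0, 1, 0, 0]]

/-- A part of type `0` or `1` is disjoint from, or contained in, the second connecting circuit; a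
part of type `2` is cut by it. -/
def Allows (t : Fin 3) (s : ZMod 2) : Prop := t = 2 ∨ t.val = s.val

instance (t : Fin 3) (s : ZMod 2) : Decidable (Allows t s) :=
  inferInstanceAs (Decidable (_ ∨ _))

/-- `h` is a coordinate vector of an element of the union of three skew circuits and two connecting
circuits, when the second connecting circuit meets the parts as described by `T`. -/
def InConfig (T : Fin 5 → Fin 3) (h : Fin 5 → ZMod 2) : Prop :=
  h = ![0, 0, 0, 1, 0] ∨ h = ![0, 0, 0, 1, 1] ∨ h = ![0, 0, 0, 0, 1] ∨
    ∃ k s, Allows (T k) s ∧ h = partVec k + s • ![0, 0, 0, 0, 1]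

instance (T : Fin 5 → Fin 3) (h : Fin 5 → ZMod 2) : Decidable (InConfig T h) :=
  inferInstanceAs (Decidable (_ ∨ _))

/-- Every matroid with configuration `T` has one of the five series minors. -/
def IsGood (α : Type*) (T : Fin 5 → Fin 3) : Prop :=
  ∀ (M : Matroid α) [M.Finite] (f : α → Fin 5 → ZMod 2), M.IsCorep f →
    f '' M.E = {h | InConfig T h} → M.HasUnavoidableMinor

/-- The type of a part of type `t` after adding `ε` to the second connecting circuit on it. -/
def shift (ε : ZMod 2) (t : Fin 3) : Fin 3 := if ε = 0 then t else ![1, 0, 2] t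

lemma allows_shift (ε s : ZMod 2) (t : Fin 3) : Allows (shift ε t) (s + ε) ↔ Allows t s := by
  revert ε s t
  decide +kernel

/-- The matroid stays the same and only the cycle basis changes: `A` moves part `k` to part `σ k`
and adds `ε k` to the value of the second connecting circuit there. All moves used are involutions,
so one containment of vector sets gives the other. -/
lemma IsGood.of_basis_change {T T' : Fin 5 → Fin 3} (h : IsGood α T')
    (A : Matrix (Fin 5) (Fin 5) (ZMod 2)) (σ : Fin 5 → Fin 5) (ε : Fin 5 → ZMod 2)
    (hA : A * A = 1) (hσ : ∀ k, σ (σ k) = k)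
    (hA3 : A.mulVec ![0, 0, 0, 1, 0] = ![0, 0, 0, 1, 0])
    (hA4 : A.mulVec ![0, 0, 0, 0, 1] = ![0, 0, 0, 0, 1])
    (hAp : ∀ k, A.mulVec (partVec k) = partVec (σ k) + ε k • ![0, 0, 0, 0, 1])
    (hT : ∀ k, T' (σ k) = shift (ε k) (T k)) : IsGood α T := by
  intro M _ f hf hfE
  refine h M _ (hf.mulVec hA) ?_
  rw [← Set.image_image (fun x ↦ A.mulVec x), hfE]
  have hA34 : A.mulVec ![0, 0, 0, 1, 1] = ![0, 0, 0, 1, 1] := by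
    have : (![0, 0, 0, 1, 1] : Fin 5 → ZMod 2) = ![0, 0, 0, 1, 0] + ![0, 0, 0, 0, 1] := by
      decide +kernel
    rw [this, Matrix.mulVec_add, hA3, hA4]
  have hpart : ∀ k s, A.mulVec (partVec k + s • ![0, 0, 0, 0, 1]) =
      partVec (σ k) + (s + ε k) • ![0, 0, 0, 0, 1] := by
    intro k s
    rw [Matrix.mulVec_add, Matrix.mulVec_smul, hA4, hAp, add_assoc, ← add_smul, add_comm s]
  refine Set.Subset.antisymm ?_ ?_
  · rintro _ ⟨x, hx, rfl⟩
    rcases hx with rfl | rfl | rfl | ⟨k, s, hks, rfl⟩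
    · exact Or.inl hA3
    · exact Or.inr (Or.inl hA34)
    · exact Or.inr (Or.inr (Or.inl hA4))
    · refine Or.inr (Or.inr (Or.inr ⟨σ k, s + ε k, ?_, hpart k s⟩))
      rwa [hT, allows_shift]
  · intro x hx
    rcases hx with rfl | rfl | rfl | ⟨k, s, hks, rfl⟩
    · exact ⟨_, Or.inl rfl, hA3⟩
    · exact ⟨_, Or.inr (Or.inl rfl), hA34⟩
    · exact ⟨_, Or.inr (Or.inr (Or.inl rfl)), hA4⟩
    · have h2 : s + ε (σ k) + ε (σ k) = s := by
        rw [add_assoc, CharTwo.add_self_eq_zero, add_zero]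
      -- The preimage lies in part `σ k`; applying `A` adds `ε (σ k)` a second time, which cancels.
      refine ⟨_, Or.inr (Or.inr (Or.inr ⟨σ k, s + ε (σ k), ?_, rfl⟩)), ?_⟩
      · rwa [← allows_shift (ε (σ k)), ← hT, hσ, h2]
      · change A.mulVec _ = _
        rw [hpart, hσ, h2]

/-- The effect on configurations of the changes of basis that add a circuit to the second
connecting circuit, that add a skew circuit to the first connecting circuit, and that exchange the
two skew circuits met by the latter. -/
def basisChange (i : Fin 6) (T : Fin 5 → Fin 3) : Fin 5 → Fin 3 :=
  ![![shift 1 (T 0), shift 1 (T 1), T 2, T 3, T 4],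
    ![T 0, T 1, shift 1 (T 2), shift 1 (T 3), T 4],
    ![T 0, shift 1 (T 1), T 2, shift 1 (T 3), shift 1 (T 4)],
    ![T 1, T 0, T 2, T 3, T 4], ![T 0, T 1, T 3, T 2, T 4], ![T 2, T 3, T 0, T 1, T 4]] i

lemma IsGood.of_basisChange {i : Fin 6} {T : Fin 5 → Fin 3} (h : IsGood α (basisChange i T)) :
    IsGood α T := by
  fin_cases i
  · refine h.of_basis_change
      !![1, 0, 0, 0, 0; 0, 1, 0, 0, 0; 0, 0, 1, 0, 0; 0, 0, 0, 1, 0; 1, 0, 0, 0, 1] id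
      ![1, 1, 0, 0, 0] ?_ ?_ ?_ ?_ ?_ (by intro k; fin_cases k <;> rfl) <;> decide +kernel
  · refine h.of_basis_change
      !![1, 0, 0, 0, 0; 0, 1, 0, 0, 0; 0, 0, 1, 0, 0; 0, 0, 0, 1, 0; 0, 1, 0, 0, 1] id
      ![0, 0, 1, 1, 0] ?_ ?_ ?_ ?_ ?_ (by intro k; fin_cases k <;> rfl) <;> decide +kernel
  · refine h.of_basis_change
      !![1, 0, 0, 0, 0; 0, 1, 0, 0, 0; 0, 0, 1, 0, 0; 0, 0, 0, 1, 0; 0, 0, 1, 0, 1] id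
      ![0, 1, 0, 1, 1] ?_ ?_ ?_ ?_ ?_ (by intro k; fin_cases k <;> rfl) <;> decide +kernel
  · refine h.of_basis_change
      !![1, 0, 0, 0, 0; 0, 1, 0, 0, 0; 1, 0, 1, 0, 0; 0, 0, 0, 1, 0; 0, 0, 0, 0, 1] ![1, 0, 2, 3, 4]
      0 ?_ ?_ ?_ ?_ ?_ (by intro k; fin_cases k <;> rfl) <;> decide +kernel
  · refine h.of_basis_change
      !![1, 0, 0, 0, 0; 0, 1, 0, 0, 0; 0, 1, 1, 0, 0; 0, 0, 0, 1, 0; 0, 0, 0, 0, 1] ![0, 1, 3, 2, 4]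
      0 ?_ ?_ ?_ ?_ ?_ (by intro k; fin_cases k <;> rfl) <;> decide +kernel
  · refine h.of_basis_change
      !![0, 1, 0, 0, 0; 1, 0, 0, 0, 0; 0, 0, 1, 0, 0; 0, 0, 0, 1, 0; 0, 0, 0, 0, 1] ![2, 3, 0, 1, 4]
      0 ?_ ?_ ?_ ?_ ?_ (by intro k; fin_cases k <;> rfl) <;> decide +kernel

/-- If the part outside the skew circuits may be avoided by the second connecting circuit, deleting
the elements of this part that are avoided makes the first two skew circuits parts of one circuit
that meets all three. -/
def CanDelete (T : Fin 5 → Fin 3) : Prop :=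
  Allows (T 4) 0 ∧ (∀ s, Allows (T 0) s ∨ Allows (T 1) s) ∧ ∀ s, Allows (T 2) s ∨ Allows (T 3) s

instance (T : Fin 5 → Fin 3) : Decidable (CanDelete T) :=
  inferInstanceAs (Decidable (_ ∧ _))

lemma isGood_of_canDelete {T : Fin 5 → Fin 3} (hT : CanDelete T) : IsGood α T := by
  intro M _ f hf hfE
  obtain ⟨hT4, hT0, hT2⟩ := hT
  -- The vector of the elements of `d` that lie outside `a`, `c` and `d'`.
  set z : Fin 5 → ZMod 2 := ![0, 0, 1, 0, 0] with hz
  let π : (Fin 5 → ZMod 2) → Fin 4 → ZMod 2 := fun x ↦ ![x 0, x 1, x 3, x 4]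
  have hY : {e ∈ M.E | f e ≠ z} ⊆ M.E := Set.sep_subset _ _
  have hcorep : (M ↾ {e ∈ M.E | f e ≠ z}).IsCorep fun e ↦ π (f e) := by
    refine hf.restrict hY (fun y ↦ ![y 0, y 1, 0, y 2, y 3]) (by decide +kernel) (by decide +kernel)
      ?_ ?_ ?_
    · intro e _ y
      simp [π, dotProduct, Fin.sum_univ_succ]
    · intro e he heY y
      have : f e = z := by
        by_contra hcon
        exact heY ⟨he, hcon⟩
      simp [this, hz, dotProduct, Fin.sum_univ_succ]
    -- A cycle avoiding the deleted elements has no `d`-component, so coordinate 2 disappears and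
    -- `a`, `c`, `b`, `d'` remain as basis.
    · intro y hy
      obtain ⟨e, he, hfe⟩ : z ∈ f '' M.E := by
        rw [hfE]
        exact Or.inr (Or.inr (Or.inr ⟨4, 0, hT4, by decide +kernel⟩))
      have h0 := hy e he fun h ↦ h.2 hfe
      rw [hfe] at h0
      have h2 : y 2 = 0 := by simpa [hz, dotProduct, Fin.sum_univ_succ] using h0
      refine ⟨![y 0, y 1, y 3, y 4], ?_⟩
      funext i
      fin_cases i <;> simp [h2]
  have : (M ↾ {e ∈ M.E | f e ≠ z}).Finite := ⟨M.ground_finite.subset hY⟩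
  refine (hcorep.hasUnavoidableMinor_L₁ ?_).mono (M.restrict_isSeriesMinor hY)
  refine Set.Subset.antisymm ?_ ?_
  · rintro _ ⟨e, ⟨he, hez⟩, rfl⟩
    have hin : InConfig T (f e) := hfE.subset (Set.mem_image_of_mem f he)
    change π (f e) ∈ Set.range Graph.coords₁
    revert hez hin
    generalize f e = x
    intro hez hin
    rcases hin with rfl | rfl | rfl | ⟨k, s, -, rfl⟩
    · exact ⟨4, by decide +kernel⟩
    · exact ⟨5, by decide +kernel⟩
    · exact ⟨6, by decide +kernel⟩
    · revert k s
      have : ∀ (k : Fin 5) (s : ZMod 2), partVec k + s • ![0, 0, 0, 0, 1] ≠ z →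
          ∃ i, Graph.coords₁ i = π (partVec k + s • ![0, 0, 0, 0, 1]) := by
        decide +kernel
      exact this
  · have key : ∀ x, InConfig T x → x ≠ z → π x ∈ (fun e ↦ π (f e)) '' {e ∈ M.E | f e ≠ z} := by
      intro x hx hxz
      obtain ⟨e, he, rfl⟩ := hfE.superset hx
      exact ⟨e, ⟨he, hxz⟩, rfl⟩
    have key' : ∀ (k : Fin 5) (s : ZMod 2) (i : Fin 7), Allows (T k) s →
        partVec k + s • ![0, 0, 0, 0, 1] ≠ z →
        π (partVec k + s • ![0, 0, 0, 0, 1]) = Graph.coords₁ i →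
        Graph.coords₁ i ∈ (fun e ↦ π (f e)) '' {e ∈ M.E | f e ≠ z} := by
      intro k s i hks hne h
      rw [← h]
      exact key _ (Or.inr (Or.inr (Or.inr ⟨k, s, hks, rfl⟩))) hne
    rintro _ ⟨i, rfl⟩
    -- Without coordinate 2 the parts 0 and 1 merge into `a`, and 2 and 3 into `c`; each required
    -- value of `d'` may come from either part.
    fin_cases i
    · exact (hT0 0).elim (fun h ↦ key' 0 0 0 h (by decide +kernel) (by decide +kernel))
        fun h ↦ key' 1 0 0 h (by decide +kernel) (by decide +kernel)
    · exact (hT0 1).elim (fun h ↦ key' 0 1 1 h (by decide +kernel) (by decide +kernel))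
        fun h ↦ key' 1 1 1 h (by decide +kernel) (by decide +kernel)
    · exact (hT2 0).elim (fun h ↦ key' 2 0 2 h (by decide +kernel) (by decide +kernel))
        fun h ↦ key' 3 0 2 h (by decide +kernel) (by decide +kernel)
    · exact (hT2 1).elim (fun h ↦ key' 2 1 3 h (by decide +kernel) (by decide +kernel))
        fun h ↦ key' 3 1 3 h (by decide +kernel) (by decide +kernel)
    · have h : Graph.coords₁ 4 = π ![0, 0, 0, 1, 0] := by decide +kernel
      exact h ▸ key _ (Or.inl rfl) (by decide +kernel)
    · have h : Graph.coords₁ 5 = π ![0, 0, 0, 1, 1] := by decide +kernel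
      exact h ▸ key _ (Or.inr (Or.inl rfl)) (by decide +kernel)
    · have h : Graph.coords₁ 6 = π ![0, 0, 0, 0, 1] := by decide +kernel
      exact h ▸ key _ (Or.inr (Or.inr (Or.inl rfl))) (by decide +kernel)

lemma isGood_of_range {T : Fin 5 → Fin 3} {k : ℕ} {g : Fin k → Fin 5 → ZMod 2}
    (h : ∀ x, InConfig T x ↔ ∃ i, g i = x) {L : Matroid (Fin k)} (hL : L.E = Set.univ)
    (hg : L.IsCorep g) (hinj : Function.Injective g) (h0 : ∀ i, g i ≠ 0)
    (hgood : ∀ N : Matroid α, N.IsIsomorphic L → N.HasUnavoidableMinor) : IsGood α T := by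
  intro M _ f hf hfE
  obtain ⟨N, hN, hi⟩ := hf.exists_isIsomorphic hL hg hinj h0 (hfE.trans (Set.ext h))
  exact (hgood N hi).mono hN

lemma isGood_L₂ : IsGood α ![0, 0, 0, 1, 0] :=
  isGood_of_range (g := Graph.coords₂) (by decide +kernel) (Graph.ofEnds_edgeSet _)
    Graph.isCorep_L₂ (by decide +kernel) (by decide +kernel)
    fun N h ↦ ⟨N, .refl, Or.inr (Or.inl h)⟩

lemma isGood_L₃ : IsGood α ![0, 0, 0, 2, 0] :=
  isGood_of_range (g := Graph.coords₃) (by decide +kernel) (Graph.ofEnds_edgeSet _)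
    Graph.isCorep_L₃ (by decide +kernel) (by decide +kernel)
    fun N h ↦ ⟨N, .refl, Or.inr (Or.inr (Or.inl h))⟩

lemma isGood_L₄ : IsGood α ![0, 0, 2, 2, 0] :=
  isGood_of_range (g := Graph.coords₄) (by decide +kernel) (Graph.ofEnds_edgeSet _)
    Graph.isCorep_L₄ (by decide +kernel) (by decide +kernel)
    fun N h ↦ ⟨N, .refl, Or.inr (Or.inr (Or.inr (Or.inl h)))⟩

lemma isGood_L₅ : IsGood α ![0, 0, 0, 1, 2] :=
  isGood_of_range (g := Graph.coords₅) (by decide +kernel) (Graph.ofEnds_edgeSet _)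
    Graph.isCorep_L₅ (by decide +kernel) (by decide +kernel)
    fun N h ↦ ⟨N, .refl, Or.inr (Or.inr (Or.inr (Or.inr h)))⟩

/-- The changes of basis `5, 4, 3, 2, 1, 0`, where those not selected by `w` are skipped. -/
def applyWord (w : Fin 6 → Bool) (T : Fin 5 → Fin 3) : Fin 5 → Fin 3 :=
  (List.finRange 6).foldr (fun i T ↦ if w i then basisChange i T else T) T

lemma IsGood.of_applyWord {w : Fin 6 → Bool} {T : Fin 5 → Fin 3} (h : IsGood α (applyWord w T)) :
    IsGood α T := by
  unfold applyWord at h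
  generalize List.finRange 6 = l at h
  induction l with
  | nil => exact h
  | cons i l ih =>
    rw [List.foldr_cons] at h
    refine ih ?_
    split_ifs at h
    · exact h.of_basisChange
    · exact h

/-- In the first alternative the second connecting circuit agrees on every part with the combination
given by `m₀`, `m₁`, `m₂`: the summand `1` turns its value into the opposite one, which no part
allows. The rest is an exhaustive check. -/
lemma exists_applyWord : ∀ a b c d e : Fin 3,
    (∃ m₀ m₁ m₂ : ZMod 2, ∀ k, ¬ Allows (![a, b, c, d, e] k)
      (m₀ * partVec k 0 + m₁ * partVec k 1 + m₂ * partVec k 2 + 1)) ∨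
    ∃ b₀ b₁ b₂ b₃ b₄ b₅ : Bool,
      CanDelete (applyWord ![b₀, b₁, b₂, b₃, b₄, b₅] ![a, b, c, d, e]) ∨
      applyWord ![b₀, b₁, b₂, b₃, b₄, b₅] ![a, b, c, d, e] ∈
        [![0, 0, 0, 1, 0], ![0, 0, 0, 2, 0], ![0, 0, 2, 2, 0], ![0, 0, 0, 1, 2]] := by
  decide +kernel

lemma isGood_of_forall_exists {T : Fin 5 → Fin 3} (hT : ∀ m₀ m₁ m₂ : ZMod 2, ∃ k, Allows (T k)
    (m₀ * partVec k 0 + m₁ * partVec k 1 + m₂ * partVec k 2 + 1)) : IsGood α T := by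
  have hT' : T = ![T 0, T 1, T 2, T 3, T 4] := by
    funext i
    fin_cases i <;> rfl
  rcases exists_applyWord (T 0) (T 1) (T 2) (T 3) (T 4) with ⟨m₀, m₁, m₂, h⟩ | h
  · rw [← hT'] at h
    obtain ⟨k, hk⟩ := hT m₀ m₁ m₂
    exact absurd hk (h k)
  · rw [← hT'] at h
    obtain ⟨b₀, b₁, b₂, b₃, b₄, b₅, h⟩ := h
    refine IsGood.of_applyWord (w := ![b₀, b₁, b₂, b₃, b₄, b₅]) ?_
    rcases h with h | h
    · exact isGood_of_canDelete h
    · simp only [List.mem_cons, List.not_mem_nil, or_false] at h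
      rcases h with h | h | h | h <;> rw [h]
      exacts [isGood_L₂, isGood_L₃, isGood_L₄, isGood_L₅]

end Matroid

/-! ### Elementary vectors of the cycle space and minimal connecting circuits -/

namespace Matroid

variable {α : Type*} {W : Submodule (ZMod 2) (α →₀ ZMod 2)}

lemma mem_support_add_iff (x z : α →₀ ZMod 2) (e : α) :
    e ∈ (x + z).support ↔ ¬ (e ∈ x.support ↔ e ∈ z.support) := by
  simp only [Finsupp.mem_support_iff, Finsupp.add_apply]
  generalize x e = a
  generalize z e = b
  revert a b
  decide

lemma eq_of_support_eq {x z : α →₀ ZMod 2} (h : x.support = z.support) : x = z := by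
  ext e
  have := congrArg (e ∈ ·) h
  simp only [Finsupp.mem_support_iff, eq_iff_iff] at this
  revert this
  generalize x e = a
  generalize z e = b
  revert a b
  decide

lemma finsupp_add_self (x : α →₀ ZMod 2) : x + x = 0 := by
  ext e
  exact CharTwo.add_self_eq_zero _

lemma apply_eq_one {x : α →₀ ZMod 2} {e : α} (h : e ∈ x.support) : x e = 1 :=
  zmod_two_eq_one (Finsupp.mem_support_iff.1 h)

/-- `x` is a nonzero vector of `W` of minimal support. -/
def IsElementary (W : Submodule (ZMod 2) (α →₀ ZMod 2)) (x : α →₀ ZMod 2) : Prop :=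
  x ∈ W ∧ x ≠ 0 ∧ ∀ z ∈ W, z.support ⊆ x.support → z = 0 ∨ z = x

lemma exists_isElementary {x : α →₀ ZMod 2} (hx : x ∈ W) (h0 : x ≠ 0) :
    ∃ c, IsElementary W c ∧ c.support ⊆ x.support := by
  induction hn : x.support.card using Nat.strong_induction_on generalizing x with
  | _ n ih =>
    by_cases h : IsElementary W x
    · exact ⟨x, h, subset_rfl⟩
    · simp only [IsElementary, not_and, not_forall, not_or] at h
      obtain ⟨z, hz, hzx, hz0, hne⟩ := h hx h0
      have hlt : z.support.card < n := by
        rw [← hn]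
        exact Finset.card_lt_card (hzx.ssubset_of_ne fun h ↦ hne (eq_of_support_eq h))
      obtain ⟨c, hc, hcz⟩ := ih _ hlt hz hz0 rfl
      exact ⟨c, hc, hcz.trans hzx⟩

/-- A vector none of whose elementary parts meets both `P` and `Q` is a disjoint sum of a vector
that misses `Q` and a vector that misses `P`. -/
lemma exists_split {P Q : Set α} {x : α →₀ ZMod 2} (hx : x ∈ W)
    (h : ∀ c, IsElementary W c → c.support ⊆ x.support →
      Disjoint (c.support : Set α) P ∨ Disjoint (c.support : Set α) Q) :
    ∃ p ∈ W, ∃ q ∈ W, x = p + q ∧ Disjoint p.support q.support ∧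
      Disjoint (p.support : Set α) Q ∧ Disjoint (q.support : Set α) P := by
  induction hn : x.support.card using Nat.strong_induction_on generalizing x with
  | _ n ih =>
    by_cases h0 : x = 0
    · exact ⟨0, W.zero_mem, 0, W.zero_mem, by simp [h0], by simp, by simp, by simp⟩
    -- Split off one elementary part `c`, split the remainder by induction, and return `c` to a side
    -- it is compatible with.
    obtain ⟨c, hc, hcx⟩ := exists_isElementary hx h0
    have hsub : ∀ e ∈ (x + c).support, e ∈ x.support ∧ e ∉ c.support := by
      intro e he
      rw [mem_support_add_iff] at he
      have := @hcx e
      tauto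
    have hlt : (x + c).support.card < n := by
      rw [← hn]
      refine Finset.card_lt_card ⟨fun e he ↦ (hsub e he).1, fun hle ↦ ?_⟩
      obtain ⟨e, he⟩ := Finsupp.support_nonempty_iff.2 hc.2.1
      exact (hsub e (hle (hcx he))).2 he
    obtain ⟨p, hp, q, hq, hpq, hd, hpQ, hqP⟩ := ih _ hlt (W.add_mem hx hc.1)
      (fun c' hc' hsub' ↦ h c' hc' fun e he ↦ (hsub e (hsub' he)).1) rfl
    have hx' : x = p + q + c := by rw [← hpq, add_assoc, finsupp_add_self, add_zero]
    have hcpq : ∀ e ∈ c.support, e ∉ p.support ∧ e ∉ q.support := by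
      intro e he
      have h1 : e ∉ (p + q).support := by
        rw [← hpq]
        exact fun h ↦ (hsub e h).2 he
      rw [mem_support_add_iff, not_not] at h1
      have := fun h : e ∈ p.support ↦ Finset.disjoint_left.1 hd h
      tauto
    rw [Set.disjoint_left] at hpQ hqP
    rw [Finset.disjoint_left] at hd
    rcases h c hc hcx with hcP | hcQ
    · rw [Set.disjoint_left] at hcP
      refine ⟨p, hp, q + c, W.add_mem hq hc.1, by rw [hx', add_assoc], ?_, ?_, ?_⟩
      · rw [Finset.disjoint_left]
        intro e he he'
        rw [mem_support_add_iff] at he'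
        have := hd he
        have := hcpq e
        tauto
      · rwa [Set.disjoint_left]
      · rw [Set.disjoint_left]
        intro e he
        rw [Finset.mem_coe, mem_support_add_iff] at he
        by_cases hec : e ∈ c.support
        · exact hcP hec
        · exact hqP (show e ∈ q.support by tauto)
    · rw [Set.disjoint_left] at hcQ
      refine ⟨p + c, W.add_mem hp hc.1, q, hq, by rw [hx', add_right_comm], ?_, ?_, ?_⟩
      · rw [Finset.disjoint_left]
        intro e he he'
        rw [mem_support_add_iff] at he
        have : e ∉ p.support := fun h ↦ hd h he'
        have := hcpq e
        tauto
      · rw [Set.disjoint_left]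
        intro e he
        rw [Finset.mem_coe, mem_support_add_iff] at he
        by_cases hec : e ∈ c.support
        · exact hcQ hec
        · exact hpQ (show e ∈ p.support by tauto)
      · rwa [Set.disjoint_left]

/-- An elementary vector that meets `P` and `Q` and has as few elements outside `P ∪ Q` as
possible raises the dimension by at most one. -/
lemma exists_connecting {P Q : Set α} (h : ∃ c, IsElementary W c ∧
      ¬ Disjoint (c.support : Set α) P ∧ ¬ Disjoint (c.support : Set α) Q) :
    ∃ d, IsElementary W d ∧ ¬ Disjoint (d.support : Set α) P ∧ ¬ Disjoint (d.support : Set α) Q ∧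
      ∀ z ∈ W, (z.support : Set α) ⊆ P ∪ Q ∪ d.support →
        (z.support : Set α) ⊆ P ∪ Q ∨ ((z + d).support : Set α) ⊆ P ∪ Q := by
  classical
  have hex : ∃ n, ∃ d, (IsElementary W d ∧ ¬ Disjoint (d.support : Set α) P ∧
      ¬ Disjoint (d.support : Set α) Q) ∧ (d.support.filter (· ∉ P ∪ Q)).card = n := by
    obtain ⟨c, hc⟩ := h
    exact ⟨_, c, hc, rfl⟩
  obtain ⟨d, ⟨hd, hdP, hdQ⟩, hdn⟩ := Nat.find_spec hex
  have hmin := fun m hm ↦ Nat.find_min hex (m := m) hm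
  rw [← hdn] at hmin
  refine ⟨d, hd, hdP, hdQ, fun z hz hzs ↦ ?_⟩
  -- If `x + d` leaves `P ∪ Q`, then `x` misses an element of `d` outside `P ∪ Q`. An elementary
  -- part of `x` meeting both sides would then contradict the minimality of `d`.
  have hcut : ∀ x ∈ W, (x.support : Set α) ⊆ P ∪ Q ∪ d.support →
      ¬ ((x + d).support : Set α) ⊆ P ∪ Q → ∃ p ∈ W, ∃ q ∈ W, x = p + q ∧
        Disjoint p.support q.support ∧ Disjoint (p.support : Set α) Q ∧
        Disjoint (q.support : Set α) P := by
    intro x hx hxs hxd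
    refine exists_split hx fun c hc hcx ↦ ?_
    by_contra! hcon
    refine hmin _ ?_ ⟨c, ⟨hc, hcon⟩, rfl⟩
    rw [Set.not_subset] at hxd
    obtain ⟨e, he, heU⟩ := hxd
    have hsub : ∀ e' ∈ x.support, e' ∉ P ∪ Q → e' ∈ d.support := fun e' he' heU ↦
      (hxs he').resolve_left heU
    rw [Finset.mem_coe, mem_support_add_iff] at he
    refine Finset.card_lt_card ⟨fun e' he' ↦ ?_, fun hle ↦ ?_⟩
    · rw [Finset.mem_filter] at he' ⊢
      exact ⟨hsub e' (hcx he'.1) he'.2, he'.2⟩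
    · have hed : e ∈ d.support := by
        have := hsub e
        tauto
      have := hcx (Finset.mem_filter.1 (hle (Finset.mem_filter.2 ⟨hed, heU⟩))).1
      tauto
  by_contra! hcon
  obtain ⟨hz1, hz2⟩ := hcon
  obtain ⟨p, hp, q, hq, hpq, hd1, hpQ, hqP⟩ := hcut z hz hzs hz2
  have hzd : z + d + d = z := by rw [add_assoc, finsupp_add_self, add_zero]
  obtain ⟨p', hp', q', hq', hpq', hd1', hpQ', hqP'⟩ := hcut (z + d) (W.add_mem hz hd.1) (by
    intro e he
    rw [Finset.mem_coe, mem_support_add_iff] at he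
    by_cases hed : e ∈ d.support
    · exact Or.inr hed
    · exact hzs (show e ∈ z.support by tauto)) (by rwa [hzd])
  -- Both `z` and `z + d` split, so `d` splits into a vector missing `Q` and one missing `P`. They
  -- are disjoint, because outside `P ∪ Q` the supports of `z` and `z + d` are disjoint. Being
  -- elementary, `d` equals one of them and so misses `P` or `Q`.
  have hsum : d = (p + p') + (q + q') := by
    have : d = z + (z + d) := by rw [← add_assoc, finsupp_add_self, zero_add]
    rw [this, hpq', hpq]
    abel
  have hzmem : ∀ e, e ∈ z.support ↔ (e ∈ p.support ∨ e ∈ q.support) := by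
    intro e
    rw [hpq, mem_support_add_iff]
    have := fun h : e ∈ p.support ↦ Finset.disjoint_left.1 hd1 h
    tauto
  have hzdmem : ∀ e, e ∈ (z + d).support ↔ (e ∈ p'.support ∨ e ∈ q'.support) := by
    intro e
    rw [hpq', mem_support_add_iff]
    have := fun h : e ∈ p'.support ↦ Finset.disjoint_left.1 hd1' h
    tauto
  rw [Set.disjoint_left] at hpQ hqP hpQ' hqP'
  have hdis : ∀ e, e ∈ (p + p').support → e ∉ (q + q').support := by
    intro e he he'
    rw [mem_support_add_iff] at he he'
    have h1 := hzmem e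
    have h2 := hzdmem e
    rw [mem_support_add_iff] at h2
    have h3 := @hpQ e
    have h4 := @hqP e
    have h5 := @hpQ' e
    have h6 := @hqP' e
    have h7 := @hzs e
    have h8 := fun h : e ∈ p.support ↦ Finset.disjoint_left.1 hd1 h
    have h9 := fun h : e ∈ p'.support ↦ Finset.disjoint_left.1 hd1' h
    simp only [Set.mem_union, Finset.mem_coe] at h3 h4 h5 h6 h7
    grind
  have hsubP : (p + p').support ⊆ d.support := by
    intro e he
    rw [hsum, mem_support_add_iff]
    have := hdis e he
    tauto
  rcases hd.2.2 _ (W.add_mem hp hp') hsubP with h0 | h0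
  · refine hdP (Set.disjoint_left.2 fun e he heP ↦ ?_)
    rw [hsum, h0, zero_add, Finset.mem_coe, mem_support_add_iff] at he
    have h1 := fun h ↦ @hqP e h heP
    have h2 := fun h ↦ @hqP' e h heP
    simp only [Finset.mem_coe] at h1 h2
    tauto
  · refine hdQ (Set.disjoint_left.2 fun e he heQ ↦ ?_)
    rw [← h0, Finset.mem_coe, mem_support_add_iff] at he
    have h1 := fun h ↦ @hpQ e h heQ
    have h2 := fun h ↦ @hpQ' e h heQ
    simp only [Finset.mem_coe] at h1 h2
    tauto

/-- `W` consists of the cycles of the binary matroid `M`. -/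
def IsCycleSpace (M : Matroid α) (W : Submodule (ZMod 2) (α →₀ ZMod 2)) : Prop :=
  (∀ x ∈ W, (x.support : Set α) ⊆ M.E) ∧
    ∀ I ⊆ M.E, M.Indep I ↔ ∀ x ∈ W, (x.support : Set α) ⊆ I → x = 0

lemma IsBinary.exists_isCycleSpace {M : Matroid α} (h : M.IsBinary) :
    ∃ W, M.IsCycleSpace W := by
  obtain ⟨n, v, hv⟩ := h
  refine ⟨Finsupp.supported (ZMod 2) (ZMod 2) M.E ⊓
    LinearMap.ker (Finsupp.linearCombination (ZMod 2) v), fun x hx ↦ hx.1, fun I hI ↦ ?_⟩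
  rw [hv I hI, linearIndepOn_iff]
  exact ⟨fun H x hx hxI ↦ H x hxI hx.2, fun H x hxI hx ↦ H x ⟨hxI.trans hI, hx⟩ hxI⟩

lemma IsCycleSpace.exists_of_isCircuit {M : Matroid α} (hW : M.IsCycleSpace W) {C : Set α}
    (hC : M.IsCircuit C) : ∃ x, IsElementary W x ∧ (x.support : Set α) = C := by
  have hdep : ∀ x ∈ W, x ≠ 0 → (x.support : Set α) ⊆ C → (x.support : Set α) = C := by
    intro x hx h0 hxC
    refine hC.eq_of_dep_subset ?_ hxC
    rw [dep_iff, hW.2 _ (hW.1 x hx)]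
    exact ⟨fun H ↦ h0 (H x hx subset_rfl), hW.1 x hx⟩
  have h1 := hC.dep.not_indep
  rw [hW.2 _ hC.subset_ground] at h1
  push Not at h1
  obtain ⟨x, hx, hxC, h0⟩ := h1
  have h2 := hdep x hx h0 hxC
  refine ⟨x, ⟨hx, h0, fun z hz hzx ↦ ?_⟩, h2⟩
  by_cases hz0 : z = 0
  · exact Or.inl hz0
  · have h3 := hdep z hz hz0 (h2 ▸ Finset.coe_subset.2 hzx)
    exact Or.inr (eq_of_support_eq (Finset.coe_injective (h3.trans h2.symm)))

/-- A basis of the cycles contained in `Y` represents the dual of `M ↾ Y`. -/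
lemma IsCycleSpace.isCorep_restrict {M : Matroid α} (hW : M.IsCycleSpace W) {Y : Set α}
    (hY : Y ⊆ M.E) {d : ℕ} (w : Fin d → α →₀ ZMod 2) (hwW : ∀ j, w j ∈ W)
    (hwY : ∀ j, ((w j).support : Set α) ⊆ Y)
    (hspan : ∀ x ∈ W, (x.support : Set α) ⊆ Y → ∃ y : Fin d → ZMod 2, x = ∑ j, y j • w j)
    (hind : ∀ y : Fin d → ZMod 2, (∀ e ∈ Y, (fun j ↦ w j e) ⬝ᵥ y = 0) → y = 0) :
    (M ↾ Y).IsCorep fun e j ↦ w j e := by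
  have happ : ∀ (y : Fin d → ZMod 2) (e : α), (∑ j, y j • w j) e = (fun j ↦ w j e) ⬝ᵥ y := by
    intro y e
    simp [dotProduct, Finsupp.finsetSum_apply, mul_comm]
  have hout : ∀ (y : Fin d → ZMod 2) (e : α), e ∉ Y → (∑ j, y j • w j) e = 0 := by
    intro y e he
    rw [happ]
    refine Finset.sum_eq_zero fun j _ ↦ ?_
    have : w j e = 0 := Finsupp.notMem_support_iff.1 fun h ↦ he (hwY j h)
    simp [this]
  intro I hI
  replace hI : I ⊆ Y := hI
  rw [restrict_indep_iff, and_iff_left hI, hW.2 I (hI.trans hY)]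
  refine ⟨fun H y hy ↦ hind y fun e _ ↦ ?_, fun H x hx hxI ↦ ?_⟩
  · have h1 := H (∑ j, y j • w j) (W.sum_mem fun j _ ↦ W.smul_mem _ (hwW j)) (by
      intro e he
      by_contra heI
      refine Finsupp.mem_support_iff.1 he ?_
      by_cases heY : e ∈ Y
      · rw [happ]
        exact hy e heY heI
      · exact hout y e heY)
    rw [← happ, h1, Finsupp.zero_apply]
  · obtain ⟨y, rfl⟩ := hspan x hx (hxI.trans hI)
    have h1 := H y fun e _ heI ↦ by
      rw [← happ]
      exact Finsupp.notMem_support_iff.1 fun h ↦ heI (hxI h)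
    simp [h1]

end Matroid

/-! ### From three skew circuits to a configuration -/

namespace Matroid

variable {α : Type*} {W : Submodule (ZMod 2) (α →₀ ZMod 2)}

/-- Supports of elementary vectors are never properly nested. This ensures that a connecting circuit
leaves out part of each skew circuit. -/
lemma IsElementary.not_subset {x z : α →₀ ZMod 2} (hx : IsElementary W x) (hz : IsElementary W z)
    {e : α} (he : e ∈ x.support) (hez : e ∉ z.support) : ∃ e' ∈ z.support, e' ∉ x.support := by
  by_contra! hcon
  rcases hx.2.2 z hz.1 hcon with h | h
  · exact hz.2.1 h
  · exact hez (h ▸ he)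

/-- Three elementary vectors with disjoint supports that span the vectors of `W` supported in the
union of their supports. -/
structure IsSkewTriple (W : Submodule (ZMod 2) (α →₀ ZMod 2)) (a b c : α →₀ ZMod 2) : Prop where
  left : IsElementary W a
  mid : IsElementary W b
  right : IsElementary W c
  disj_left_mid : ∀ e ∈ a.support, e ∉ b.support
  disj_left_right : ∀ e ∈ a.support, e ∉ c.support
  disj_mid_right : ∀ e ∈ b.support, e ∉ c.support
  span : ∀ z ∈ W, (∀ e ∈ z.support, e ∈ a.support ∨ e ∈ b.support ∨ e ∈ c.support) →
    ∃ r s t : ZMod 2, z = r • a + s • b + t • c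

lemma IsSkewTriple.swap {a b c : α →₀ ZMod 2} (h : IsSkewTriple W a b c) :
    IsSkewTriple W b a c where
  left := h.mid
  mid := h.left
  right := h.right
  disj_left_mid e hb ha := h.disj_left_mid e ha hb
  disj_left_right := h.disj_mid_right
  disj_mid_right := h.disj_left_right
  span z hz hzs := by
    obtain ⟨r, s, t, h⟩ := h.span z hz fun e he ↦ by have := hzs e he; tauto
    exact ⟨s, r, t, by rw [h, add_comm (r • a)]⟩

/-- `d` is elementary, meets `P` and `Q` and, together with the vectors supported in `P ∪ Q`, spans
those supported in the union of `P ∪ Q` and the support of `d`. -/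
structure IsConnecting (W : Submodule (ZMod 2) (α →₀ ZMod 2)) (d : α →₀ ZMod 2) (P Q : Set α) :
    Prop where
  elem : IsElementary W d
  meets_left : ∃ e ∈ d.support, e ∈ P
  meets_right : ∃ e ∈ d.support, e ∈ Q
  span : ∀ z ∈ W, (∀ e ∈ z.support, e ∈ P ∨ e ∈ Q ∨ e ∈ d.support) →
    ∃ u ∈ W, ∃ r : ZMod 2, (∀ e ∈ u.support, e ∈ P ∨ e ∈ Q) ∧ z = u + r • d

lemma exists_isConnecting {P Q : Set α}
    (h : ∃ c, IsElementary W c ∧ (∃ e ∈ c.support, e ∈ P) ∧ ∃ e ∈ c.support, e ∈ Q) :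
    ∃ d, IsConnecting W d P Q := by
  have hmeet : ∀ (x : α →₀ ZMod 2) (R : Set α),
      ¬ Disjoint (x.support : Set α) R ↔ ∃ e ∈ x.support, e ∈ R := by
    intro x R
    rw [Set.not_disjoint_iff]
    rfl
  obtain ⟨d, hd, hdP, hdQ, hspan⟩ := exists_connecting (P := P) (Q := Q)
    (by simpa only [hmeet] using h)
  refine ⟨d, hd, (hmeet _ _).1 hdP, (hmeet _ _).1 hdQ, fun z hz hzs ↦ ?_⟩
  rcases hspan z hz fun e he ↦ or_assoc.2 (hzs e he) with h1 | h1
  · exact ⟨z, hz, 0, fun e he ↦ h1 he, by simp⟩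
  · refine ⟨z + d, W.add_mem hz hd.1, 1, fun e he ↦ h1 he, ?_⟩
    rw [one_smul, add_assoc, finsupp_add_self, add_zero]

variable {M : Matroid α} {a b c d d' : α →₀ ZMod 2}

/-- An elementary vector that meets `a` and `c` is not supported in the union of the triple. -/
lemma IsSkewTriple.exists_outside (h : IsSkewTriple W a b c) (hd : IsElementary W d)
    (ha : ∃ e ∈ d.support, e ∈ a.support) (hc : ∃ e ∈ d.support, e ∈ c.support) :
    ∃ e ∈ d.support, e ∉ a.support ∧ e ∉ b.support ∧ e ∉ c.support := by
  by_contra! hcon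
  obtain ⟨e, hed, hea⟩ := ha
  obtain ⟨e', hed', hec'⟩ := hc
  obtain ⟨r, s, t, hrst⟩ := h.span d hd.1 fun e he ↦ by have := hcon e he; tauto
  have hr : r = 1 := by
    have h1 := apply_eq_one hed
    have h2 := apply_eq_one hea
    have h3 := Finsupp.notMem_support_iff.1 (h.disj_left_mid e hea)
    have h4 := Finsupp.notMem_support_iff.1 (h.disj_left_right e hea)
    rw [hrst] at h1
    simpa [h2, h3, h4] using h1
  -- Coefficient `r = 1` would put all of `a` inside `d`, which also meets `c`.
  obtain ⟨f, hfa, hfd⟩ := hd.not_subset h.left hed' fun hea' ↦ h.disj_left_right e' hea' hec'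
  refine hfd (Finsupp.mem_support_iff.2 ?_)
  have h2 := apply_eq_one hfa
  have h3 := Finsupp.notMem_support_iff.1 (h.disj_left_mid f hfa)
  have h4 := Finsupp.notMem_support_iff.1 (h.disj_left_right f hfa)
  rw [hrst, hr]
  simp [h2, h3, h4]

set_option synthInstance.maxSize 1000 in
set_option synthInstance.maxHeartbeats 200000 in
-- Here `d` cuts each of the three circuits into two nonempty parts and has an element outside them:
-- seven series classes, one for each edge of `L₁`.
lemma IsSkewTriple.hasUnavoidableMinor_of_meets [M.Finite] (hW : M.IsCycleSpace W)
    (h : IsSkewTriple W a b c) (hd : IsConnecting W d (a.support ∪ b.support) c.support)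
    (ha : ∃ e ∈ d.support, e ∈ a.support) (hb : ∃ e ∈ d.support, e ∈ b.support) :
    M.HasUnavoidableMinor := by
  have hc : ∃ e ∈ d.support, e ∈ c.support := hd.meets_right
  obtain ⟨o, hod, hoa, hob, hoc⟩ := h.exists_outside hd.elem ha hc
  obtain ⟨a₁, had₁, ha₁⟩ := ha
  obtain ⟨b₁, hbd₁, hb₁⟩ := hb
  obtain ⟨c₁, hcd₁, hc₁⟩ := hc
  obtain ⟨a₀, ha₀, had₀⟩ := hd.elem.not_subset h.left hod hoa
  obtain ⟨b₀, hb₀, hbd₀⟩ := hd.elem.not_subset h.mid hod hob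
  obtain ⟨c₀, hc₀, hcd₀⟩ := hd.elem.not_subset h.right hod hoc
  set Y : Set α := {e | e ∈ a.support ∨ e ∈ b.support ∨ e ∈ c.support ∨ e ∈ d.support} with hYdef
  have hY : Y ⊆ M.E := by
    rintro e (he | he | he | he)
    exacts [hW.1 a h.left.1 he, hW.1 b h.mid.1 he, hW.1 c h.right.1 he, hW.1 d hd.elem.1 he]
  set w : Fin 4 → α →₀ ZMod 2 := ![a, b, c, d] with hw
  set f : α → Fin 4 → ZMod 2 := fun e j ↦ w j e with hf
  have hfe : ∀ e, f e = ![a e, b e, c e, d e] := by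
    intro e
    funext j
    fin_cases j <;> rfl
  have hfY : f '' Y = Set.range Graph.coords₁ := by
    have hmem : ∀ e ∈ Y, ∀ v, f e = v → v ∈ f '' Y := fun e he v hv ↦ ⟨e, he, hv⟩
    refine Set.Subset.antisymm ?_ ?_
    · rintro _ ⟨e, he, rfl⟩
      rw [hfe]
      have h1 := h.disj_left_mid e
      have h2 := h.disj_left_right e
      have h3 := h.disj_mid_right e
      change e ∈ a.support ∨ e ∈ b.support ∨ e ∈ c.support ∨ e ∈ d.support at he
      simp only [Finsupp.mem_support_iff] at h1 h2 h3 he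
      revert h1 h2 h3 he
      generalize a e = x₁
      generalize b e = x₂
      generalize c e = x₃
      generalize d e = x₄
      revert x₁ x₂ x₃ x₄
      change ∀ x₁ x₂ x₃ x₄ : ZMod 2, _ → _ → _ → _ → ∃ i, _
      decide +kernel
    · have hval : ∀ e x₁ x₂ x₃ x₄, a e = x₁ → b e = x₂ → c e = x₃ → d e = x₄ →
          f e = ![x₁, x₂, x₃, x₄] := by
        rintro e _ _ _ _ rfl rfl rfl rfl
        exact hfe e
      have h0 : ∀ {x : α →₀ ZMod 2} {e : α}, e ∉ x.support → x e = 0 :=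
        Finsupp.notMem_support_iff.1
      rintro _ ⟨i, rfl⟩
      fin_cases i
      · exact hmem a₀ (Or.inl ha₀) _ (hval _ _ _ _ _ (apply_eq_one ha₀)
          (h0 (h.disj_left_mid _ ha₀)) (h0 (h.disj_left_right _ ha₀)) (h0 had₀))
      · exact hmem a₁ (Or.inl ha₁) _ (hval _ _ _ _ _ (apply_eq_one ha₁)
          (h0 (h.disj_left_mid _ ha₁)) (h0 (h.disj_left_right _ ha₁)) (apply_eq_one had₁))
      · exact hmem b₀ (Or.inr (Or.inl hb₀)) _ (hval _ _ _ _ _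
          (h0 fun h' ↦ h.disj_left_mid _ h' hb₀) (apply_eq_one hb₀)
          (h0 (h.disj_mid_right _ hb₀)) (h0 hbd₀))
      · exact hmem b₁ (Or.inr (Or.inl hb₁)) _ (hval _ _ _ _ _
          (h0 fun h' ↦ h.disj_left_mid _ h' hb₁) (apply_eq_one hb₁)
          (h0 (h.disj_mid_right _ hb₁)) (apply_eq_one hbd₁))
      · exact hmem c₀ (Or.inr (Or.inr (Or.inl hc₀))) _ (hval _ _ _ _ _
          (h0 fun h' ↦ h.disj_left_right _ h' hc₀) (h0 fun h' ↦ h.disj_mid_right _ h' hc₀)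
          (apply_eq_one hc₀) (h0 hcd₀))
      · exact hmem c₁ (Or.inr (Or.inr (Or.inl hc₁))) _ (hval _ _ _ _ _
          (h0 fun h' ↦ h.disj_left_right _ h' hc₁) (h0 fun h' ↦ h.disj_mid_right _ h' hc₁)
          (apply_eq_one hc₁) (apply_eq_one hcd₁))
      · exact hmem o (Or.inr (Or.inr (Or.inr hod))) _ (hval _ _ _ _ _ (h0 hoa) (h0 hob) (h0 hoc)
          (apply_eq_one hod))
  have hcorep : (M ↾ Y).IsCorep f := by
    refine hW.isCorep_restrict hY w ?_ ?_ ?_ ?_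
    · intro j
      fin_cases j
      exacts [h.left.1, h.mid.1, h.right.1, hd.elem.1]
    · intro j
      fin_cases j
      exacts [fun e he ↦ Or.inl he, fun e he ↦ Or.inr (Or.inl he),
        fun e he ↦ Or.inr (Or.inr (Or.inl he)), fun e he ↦ Or.inr (Or.inr (Or.inr he))]
    · intro z hz hzY
      obtain ⟨u, hu, r, hus, hzu⟩ := hd.span z hz fun e he ↦ by
        have := hzY he
        simp only [hYdef, Set.mem_ofPred_eq] at this
        simp only [Set.mem_union, Finset.mem_coe]
        tauto
      obtain ⟨r', s, t, hu'⟩ := h.span u hu fun e he ↦ by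
        have := hus e he
        simp only [Set.mem_union, Finset.mem_coe] at this
        tauto
      exact ⟨![r', s, t, r], by simp [hzu, hu', Fin.sum_univ_succ, hw, add_assoc]⟩
    · intro y hy
      -- The basis is independent because the coordinate vectors of `L₁` span.
      have h1 : ∀ i, Graph.coords₁ i ⬝ᵥ y = 0 := by
        intro i
        obtain ⟨e, he, hei⟩ := hfY.superset ⟨i, rfl⟩
        rw [← hei]
        exact hy e he
      revert y
      have : ∀ y : Fin 4 → ZMod 2, (∀ i, Graph.coords₁ i ⬝ᵥ y = 0) → y = 0 := by decide +kernel
      exact fun y _ ↦ this y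
  have : (M ↾ Y).Finite := ⟨M.ground_finite.subset hY⟩
  exact (hcorep.hasUnavoidableMinor_L₁ hfY).mono (M.restrict_isSeriesMinor hY)

/-- The three types encode the nonempty subsets of `ZMod 2`, here the values taken by `d'` on a
nonempty part. -/
lemma exists_allows {p : ZMod 2 → Prop} (hp : ∃ s, p s) : ∃ t : Fin 3, ∀ s, Allows t s ↔ p s := by
  have hforall : ∀ {q : ZMod 2 → Prop}, (∀ s, q s) ↔ q 0 ∧ q 1 := Fin.forall_fin_two
  have hexists : p 0 ∨ p 1 := Fin.exists_fin_two.1 hp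
  simp only [hforall]
  by_cases h0 : p 0 <;> by_cases h1 : p 1
  · exact ⟨2, iff_of_true (Or.inl rfl) h0, iff_of_true (Or.inl rfl) h1⟩
  · exact ⟨0, iff_of_true (by decide) h0, iff_of_false (by decide) h1⟩
  · exact ⟨1, iff_of_false (by decide) h0, iff_of_true (by decide) h1⟩
  · tauto

set_option synthInstance.maxSize 1000 in
set_option synthInstance.maxHeartbeats 200000 in
-- With the basis `a`, `c`, `d`, `b`, `d'` the coordinate vectors form a configuration `T`. The
-- condition needed by `isGood_of_forall_exists` expresses that `d'` is elementary and meets both of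
-- its sides.
lemma IsSkewTriple.hasUnavoidableMinor_of_two_connecting [M.Finite] (hW : M.IsCycleSpace W)
    (h : IsSkewTriple W a b c) (hd : IsConnecting W d (a.support ∪ b.support) c.support)
    (ha : ∃ e ∈ d.support, e ∈ a.support) (hb : ∀ e ∈ d.support, e ∉ b.support)
    (hd' : IsConnecting W d' {e | e ∈ a.support ∨ e ∈ c.support ∨ e ∈ d.support} b.support) :
    M.HasUnavoidableMinor := by
  have hc : ∃ e ∈ d.support, e ∈ c.support := hd.meets_right
  have h0 : ∀ {x : α →₀ ZMod 2} {e : α}, e ∉ x.support → x e = 0 :=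
    Finsupp.notMem_support_iff.1
  obtain ⟨o, hod, hoa, hob, hoc⟩ := h.exists_outside hd.elem ha hc
  obtain ⟨a₁, had₁, ha₁⟩ := ha
  obtain ⟨c₁, hcd₁, hc₁⟩ := hc
  obtain ⟨a₀, ha₀, had₀⟩ := hd.elem.not_subset h.left hod hoa
  obtain ⟨c₀, hc₀, hcd₀⟩ := hd.elem.not_subset h.right hod hoc
  obtain ⟨b₁, hbd₁, hb₁⟩ := hd'.meets_right
  obtain ⟨p, hpd, hp⟩ := hd'.meets_left
  have hPb : ∀ e, (e ∈ a.support ∨ e ∈ c.support ∨ e ∈ d.support) → e ∉ b.support := by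
    rintro e (he | he | he) heb
    exacts [h.disj_left_mid e he heb, h.disj_mid_right e heb he, hb e he heb]
  obtain ⟨b₀, hb₀, hbd₀⟩ := hd'.elem.not_subset h.mid hpd (hPb p hp)
  have hspan : ∀ z ∈ W, (∀ e ∈ z.support, e ∈ a.support ∨ e ∈ c.support ∨ e ∈ d.support ∨
      e ∈ b.support) → ∃ r₀ r₁ r₂ r₃ : ZMod 2, z = r₀ • a + r₁ • c + r₂ • d + r₃ • b := by
    intro z hz hzs
    obtain ⟨u, hu, r, hus, hzu⟩ := hd.span z hz fun e he ↦ by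
      have := hzs e he
      simp only [Set.mem_union, Finset.mem_coe]
      tauto
    obtain ⟨r', s, t, hu'⟩ := h.span u hu fun e he ↦ by
      have := hus e he
      simp only [Set.mem_union, Finset.mem_coe] at this
      tauto
    exact ⟨r', t, r, s, by rw [hzu, hu']; abel⟩
  -- Otherwise `d'` would be a combination of `a`, `c`, `d`, `b` and hence constant on `b`, although
  -- it contains `b₁` and not `b₀`.
  obtain ⟨o', hod', hoP, hob'⟩ : ∃ e ∈ d'.support,
      ¬ (e ∈ a.support ∨ e ∈ c.support ∨ e ∈ d.support) ∧ e ∉ b.support := by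
    by_contra! hcon
    obtain ⟨r₀, r₁, r₂, r₃, hr⟩ := hspan d' hd'.elem.1 fun e he ↦ by
      have := hcon e he
      tauto
    have hval : ∀ e ∈ b.support, d' e = r₃ := by
      intro e he
      have h1 := h0 fun h' ↦ hPb e (Or.inl h') he
      have h2 := h0 fun h' ↦ hPb e (Or.inr (Or.inl h')) he
      have h3 := h0 fun h' ↦ hPb e (Or.inr (Or.inr h')) he
      rw [hr]
      simp [h1, h2, h3, apply_eq_one he]
    have h1 := hval b₁ hb₁
    have h2 := hval b₀ hb₀
    rw [apply_eq_one hbd₁] at h1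
    rw [h0 hbd₀, ← h1] at h2
    exact zero_ne_one h2
  set Y : Set α := {e | (e ∈ a.support ∨ e ∈ c.support ∨ e ∈ d.support) ∨ e ∈ b.support ∨
    e ∈ d'.support} with hYdef
  have hY : Y ⊆ M.E := by
    rintro e ((he | he | he) | he | he)
    exacts [hW.1 a h.left.1 he, hW.1 c h.right.1 he, hW.1 d hd.elem.1 he, hW.1 b h.mid.1 he,
      hW.1 d' hd'.elem.1 he]
  set w : Fin 5 → α →₀ ZMod 2 := ![a, c, d, b, d'] with hw
  set f : α → Fin 5 → ZMod 2 := fun e j ↦ w j e with hf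
  have hfe : ∀ e, f e = ![a e, c e, d e, b e, d' e] := by
    intro e
    funext j
    fin_cases j <;> rfl
  have hval : ∀ e x₁ x₂ x₃ x₄ x₅, a e = x₁ → c e = x₂ → d e = x₃ → b e = x₄ → d' e = x₅ →
      f e = ![x₁, x₂, x₃, x₄, x₅] := by
    rintro e _ _ _ _ _ rfl rfl rfl rfl rfl
    exact hfe e
  -- All five parts are nonempty, with witnesses `a₀`, `a₁`, `c₀`, `c₁`, `o`.
  have hpart : ∀ k : Fin 5, ∃ s : ZMod 2, ∃ e ∈ Y, f e = partVec k + s • ![0, 0, 0, 0, 1] := by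
    have hadd : ∀ (k : Fin 5) (s : ZMod 2), partVec k + s • ![0, 0, 0, 0, 1] =
        ![partVec k 0, partVec k 1, partVec k 2, 0, s] := by decide +kernel
    intro k
    simp only [hadd]
    fin_cases k
    · exact ⟨d' a₀, a₀, Or.inl (Or.inl ha₀), hval _ _ _ _ _ _ (apply_eq_one ha₀)
        (h0 (h.disj_left_right _ ha₀)) (h0 had₀) (h0 (h.disj_left_mid _ ha₀)) rfl⟩
    · exact ⟨d' a₁, a₁, Or.inl (Or.inl ha₁), hval _ _ _ _ _ _ (apply_eq_one ha₁)
        (h0 (h.disj_left_right _ ha₁)) (apply_eq_one had₁) (h0 (h.disj_left_mid _ ha₁)) rfl⟩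
    · exact ⟨d' c₀, c₀, Or.inl (Or.inr (Or.inl hc₀)), hval _ _ _ _ _ _
        (h0 fun h' ↦ h.disj_left_right _ h' hc₀) (apply_eq_one hc₀) (h0 hcd₀)
        (h0 fun h' ↦ h.disj_mid_right _ h' hc₀) rfl⟩
    · exact ⟨d' c₁, c₁, Or.inl (Or.inr (Or.inl hc₁)), hval _ _ _ _ _ _
        (h0 fun h' ↦ h.disj_left_right _ h' hc₁) (apply_eq_one hc₁) (apply_eq_one hcd₁)
        (h0 fun h' ↦ h.disj_mid_right _ h' hc₁) rfl⟩
    · exact ⟨d' o, o, Or.inl (Or.inr (Or.inr hod)), hval _ _ _ _ _ _ (h0 hoa) (h0 hoc)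
        (apply_eq_one hod) (h0 hob) rfl⟩
  choose T hT using fun k ↦ exists_allows (hpart k)
  have hclass : ∀ e ∈ Y, f e = ![0, 0, 0, 1, 0] ∨ f e = ![0, 0, 0, 1, 1] ∨
      f e = ![0, 0, 0, 0, 1] ∨ ∃ (k : Fin 5) (s : ZMod 2), f e = partVec k + s • ![0, 0, 0, 0, 1] := by
    intro e he
    rw [hfe]
    have h1 := h.disj_left_right e
    have h2 := hPb e
    replace he : (e ∈ a.support ∨ e ∈ c.support ∨ e ∈ d.support) ∨ e ∈ b.support ∨
      e ∈ d'.support := he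
    simp only [Finsupp.mem_support_iff] at h1 h2 he
    revert h1 h2 he
    generalize a e = x₁
    generalize c e = x₂
    generalize d e = x₃
    generalize b e = x₄
    generalize d' e = x₅
    revert x₁ x₂ x₃ x₄ x₅
    decide +kernel
  have hfY : f '' Y = {x | InConfig T x} := by
    refine Set.Subset.antisymm ?_ ?_
    · rintro _ ⟨e, he, rfl⟩
      rcases hclass e he with h1 | h1 | h1 | ⟨k, s, h1⟩
      exacts [Or.inl h1, Or.inr (Or.inl h1), Or.inr (Or.inr (Or.inl h1)),
        Or.inr (Or.inr (Or.inr ⟨k, s, (hT k s).2 ⟨e, he, h1⟩, h1⟩))]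
    · have hbz : ∀ e ∈ b.support, a e = 0 ∧ c e = 0 ∧ d e = 0 := fun e he ↦
        ⟨h0 fun h' ↦ hPb e (Or.inl h') he, h0 fun h' ↦ hPb e (Or.inr (Or.inl h')) he,
          h0 fun h' ↦ hPb e (Or.inr (Or.inr h')) he⟩
      rintro _ (rfl | rfl | rfl | ⟨k, s, hks, rfl⟩)
      · obtain ⟨h1, h2, h3⟩ := hbz b₀ hb₀
        exact ⟨b₀, Or.inr (Or.inl hb₀), hval _ _ _ _ _ _ h1 h2 h3 (apply_eq_one hb₀) (h0 hbd₀)⟩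
      · obtain ⟨h1, h2, h3⟩ := hbz b₁ hb₁
        exact ⟨b₁, Or.inr (Or.inl hb₁), hval _ _ _ _ _ _ h1 h2 h3 (apply_eq_one hb₁)
          (apply_eq_one hbd₁)⟩
      · push Not at hoP
        exact ⟨o', Or.inr (Or.inr hod'), hval _ _ _ _ _ _ (h0 hoP.1) (h0 hoP.2.1) (h0 hoP.2.2)
          (h0 hob') (apply_eq_one hod')⟩
      · obtain ⟨e, he, hfe⟩ := (hT k s).1 hks
        exact ⟨e, he, hfe⟩
  have hcorep : (M ↾ Y).IsCorep f := by
    refine hW.isCorep_restrict hY w ?_ ?_ ?_ ?_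
    · intro j
      fin_cases j
      exacts [h.left.1, h.right.1, hd.elem.1, h.mid.1, hd'.elem.1]
    · intro j
      fin_cases j
      exacts [fun e he ↦ Or.inl (Or.inl he), fun e he ↦ Or.inl (Or.inr (Or.inl he)),
        fun e he ↦ Or.inl (Or.inr (Or.inr he)), fun e he ↦ Or.inr (Or.inl he),
        fun e he ↦ Or.inr (Or.inr he)]
    · intro z hz hzY
      obtain ⟨u, hu, r, hus, hzu⟩ := hd'.span z hz fun e he ↦ hzY he
      obtain ⟨r₀, r₁, r₂, r₃, hu'⟩ := hspan u hu fun e he ↦ by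
        have := hus e he
        simp only [Set.mem_ofPred_eq, Finset.mem_coe] at this
        tauto
      exact ⟨![r₀, r₁, r₂, r₃, r], by simp [hzu, hu', Fin.sum_univ_succ, hw, add_assoc]⟩
    · intro y hy
      have h1 : ∀ x, InConfig T x → x ⬝ᵥ y = 0 := by
        intro x hx
        obtain ⟨e, he, rfl⟩ := hfY.superset hx
        exact hy e he
      have h3 : y 3 = 0 := by
        simpa [dotProduct, Fin.sum_univ_succ] using h1 _ (Or.inl rfl)
      have h4 : y 4 = 0 := by
        simpa [dotProduct, Fin.sum_univ_succ] using h1 _ (Or.inr (Or.inr (Or.inl rfl)))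
      have h5 : ∀ k, partVec k ⬝ᵥ y = 0 := by
        intro k
        obtain ⟨s, hs⟩ := hpart k
        have := h1 _ (Or.inr (Or.inr (Or.inr ⟨k, s, (hT k s).2 hs, rfl⟩)))
        simpa [add_dotProduct, dotProduct, Fin.sum_univ_succ, h4] using this
      have h00 : y 0 = 0 := by simpa [partVec, dotProduct, Fin.sum_univ_succ] using h5 0
      have h01 : y 1 = 0 := by simpa [partVec, dotProduct, Fin.sum_univ_succ] using h5 2
      have h02 : y 2 = 0 := by simpa [partVec, dotProduct, Fin.sum_univ_succ] using h5 4
      funext i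
      fin_cases i <;> assumption
  have : (M ↾ Y).Finite := ⟨M.ground_finite.subset hY⟩
  refine (isGood_of_forall_exists (T := T) ?_ _ f hcorep hfY).mono (M.restrict_isSeriesMinor hY)
  intro m₀ m₁ m₂
  by_contra! hcon
  -- If the condition fails, `z` agrees with `d'` on `a ∪ c ∪ d` and lies in the support of `d'`.
  -- Then `z = 0` contradicts that `d'` contains `p`, and `z = d'` contradicts that it contains
  -- `b₁`.
  set z := m₀ • a + m₁ • c + m₂ • d with hz
  have hzW : z ∈ W := W.add_mem (W.add_mem (W.smul_mem _ h.left.1) (W.smul_mem _ h.right.1))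
    (W.smul_mem _ hd.elem.1)
  have hzP : ∀ e ∈ z.support, e ∈ a.support ∨ e ∈ c.support ∨ e ∈ d.support := by
    intro e he
    by_contra! hne
    refine Finsupp.mem_support_iff.1 he ?_
    simp [hz, h0 hne.1, h0 hne.2.1, h0 hne.2.2]
  have hzd : ∀ e, (e ∈ a.support ∨ e ∈ c.support ∨ e ∈ d.support) → z e = d' e := by
    intro e he
    have hbe := h0 (hPb e he)
    obtain ⟨k, s, hks⟩ : ∃ (k : Fin 5) (s : ZMod 2), f e = partVec k + s • ![0, 0, 0, 0, 1] := by
      have h3 : f e 3 = 0 := hbe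
      rcases hclass e (Or.inl he) with h1 | h1 | h1 | h1
      · simp [h1] at h3
      · simp [h1] at h3
      · rw [hfe] at h1
        have e0 : a e = 0 := congrFun h1 0
        have e1 : c e = 0 := congrFun h1 1
        have e2 : d e = 0 := congrFun h1 2
        simp only [Finsupp.mem_support_iff] at he
        tauto
      · exact h1
    have h1 : s ≠ m₀ * partVec k 0 + m₁ * partVec k 1 + m₂ * partVec k 2 + 1 := by
      rintro rfl
      exact hcon k ((hT k _).2 ⟨e, Or.inl he, hks⟩)
    have e0 : a e = partVec k 0 := by simpa using congrFun ((hfe e).symm.trans hks) 0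
    have e1 : c e = partVec k 1 := by simpa using congrFun ((hfe e).symm.trans hks) 1
    have e2 : d e = partVec k 2 := by simpa using congrFun ((hfe e).symm.trans hks) 2
    have e4 : d' e = s := by
      have h4 : ∀ k : Fin 5, partVec k 4 = 0 := by decide +kernel
      simpa [h4] using congrFun ((hfe e).symm.trans hks) 4
    have hz' : z e = m₀ * partVec k 0 + m₁ * partVec k 1 + m₂ * partVec k 2 := by
      simp [hz, e0, e1, e2]
    rw [e4, hz']
    revert h1
    generalize m₀ * partVec k 0 + m₁ * partVec k 1 + m₂ * partVec k 2 = x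
    revert s x
    have : ∀ s x : ZMod 2, s ≠ x + 1 → x = s := by decide
    exact fun s _ _ x ↦ this s x
  rcases hd'.elem.2.2 z hzW fun e he ↦ Finsupp.mem_support_iff.2
    (hzd e (hzP e he) ▸ Finsupp.mem_support_iff.1 he) with h1 | h1
  · refine Finsupp.mem_support_iff.1 hpd ?_
    rw [← hzd p hp, h1, Finsupp.zero_apply]
  · exact hPb b₁ (hzP b₁ (h1 ▸ hbd₁)) hb₁

lemma IsSkewTriple.hasUnavoidableMinor [M.Finite] (hW : M.IsCycleSpace W) (h : IsSkewTriple W a b c)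
    (hconn : ∀ e ∈ M.E, ∀ f ∈ M.E, e ≠ f → ∃ x, IsElementary W x ∧ e ∈ x.support ∧ f ∈ x.support) :
    M.HasUnavoidableMinor := by
  have hex : ∀ {x y : α →₀ ZMod 2}, IsElementary W x → IsElementary W y →
      (∀ e ∈ x.support, e ∉ y.support) → ∃ z, IsElementary W z ∧ (∃ e ∈ z.support, e ∈ x.support) ∧
        ∃ e ∈ z.support, e ∈ y.support := by
    intro x y hx hy hxy
    obtain ⟨e, he⟩ := Finsupp.support_nonempty_iff.2 hx.2.1
    obtain ⟨f, hf⟩ := Finsupp.support_nonempty_iff.2 hy.2.1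
    obtain ⟨z, hz, hez, hfz⟩ := hconn e (hW.1 x hx.1 he) f (hW.1 y hy.1 hf)
      fun hef ↦ hxy e he (hef ▸ hf)
    exact ⟨z, hz, ⟨e, hez, he⟩, f, hfz, hf⟩
  have key : ∀ {a b d : α →₀ ZMod 2}, IsSkewTriple W a b c →
      IsConnecting W d (a.support ∪ b.support) c.support → (∃ e ∈ d.support, e ∈ a.support) →
      M.HasUnavoidableMinor := by
    intro a b d h hd ha
    by_cases hb : ∃ e ∈ d.support, e ∈ b.support
    · exact h.hasUnavoidableMinor_of_meets hW hd ha hb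
    · push Not at hb
      obtain ⟨z, hz, ⟨e, hez, hea⟩, f, hfz, hfb⟩ := hex h.left h.mid h.disj_left_mid
      obtain ⟨d', hd'⟩ := exists_isConnecting (W := W)
        (P := {e | e ∈ a.support ∨ e ∈ c.support ∨ e ∈ d.support}) (Q := b.support)
        ⟨z, hz, ⟨e, hez, Or.inl hea⟩, f, hfz, hfb⟩
      exact h.hasUnavoidableMinor_of_two_connecting hW hd ha hb hd'
  -- The left side is `a ∪ b` rather than `a`, so that the minimality of `d` is relative to all
  -- three circuits; `a` and `b` are exchanged if `d` meets only `b`.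
  obtain ⟨z, hz, ⟨e, hez, hea⟩, f, hfz, hfc⟩ := hex h.left h.right h.disj_left_right
  obtain ⟨d, hd⟩ := exists_isConnecting (W := W) (P := a.support ∪ b.support) (Q := c.support)
    ⟨z, hz, ⟨e, hez, Or.inl hea⟩, f, hfz, hfc⟩
  obtain ⟨e', hed', he'⟩ := hd.meets_left
  rcases he' with he' | he'
  · exact key h hd ⟨e', hed', he'⟩
  · rw [Set.union_comm] at hd
    exact key h.swap hd ⟨e', hed', he'⟩

lemma HasSkewCircuits.exists_isSkewTriple (hW : M.IsCycleSpace W) (h : M.HasSkewCircuits 3) :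
    ∃ a b c, IsSkewTriple W a b c := by
  obtain ⟨C, hC, hdisj, hsum⟩ := h
  choose x hx hxC using fun i ↦ hW.exists_of_isCircuit (hC i)
  have hmem : ∀ i e, e ∈ (x i).support ↔ e ∈ C i := fun i e ↦ by rw [← hxC i]; rfl
  have hne : ∀ i j, i ≠ j → ∀ e ∈ (x i).support, e ∉ (x j).support := by
    intro i j hij e hei hej
    rw [hmem] at hei hej
    exact Set.disjoint_left.1 (hdisj hij) hei hej
  have hsub : ∀ z ∈ W, z ≠ 0 → (z.support : Set α) ⊆ ⋃ i, C i →
      ∃ i, (x i).support ⊆ z.support := by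
    intro z hz hz0 hzC
    by_contra! hcon
    refine hz0 ((hW.2 _ (hW.1 z hz)).1 ?_ z hz subset_rfl)
    -- If `z` contains none of the circuits, it meets each in a proper, hence independent, subset,
    -- and the direct sum makes the union of these independent.
    have h1 : (M ↾ ⋃ i, C i).Indep z.support := by
      rw [hsum, disjointSigma_indep_iff]
      refine ⟨fun i ↦ ?_, by simpa using hzC⟩
      rw [restrict_ground_eq, restrict_indep_iff, and_iff_left Set.inter_subset_right]
      refine (hC i).ssubset_indep (Set.inter_subset_right.ssubset_of_ne fun heq ↦ hcon i ?_)
      rw [Set.inter_eq_right, ← hxC i] at heq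
      exact Finset.coe_subset.1 heq
    exact h1.of_restrict
  refine ⟨x 0, x 1, x 2, hx 0, hx 1, hx 2, hne 0 1 (by decide), hne 0 2 (by decide),
    hne 1 2 (by decide), ?_⟩
  intro z hz hzs
  have key : ∃ y : Fin 3 → ZMod 2, z = ∑ i, y i • x i := by
    have hzC : (z.support : Set α) ⊆ ⋃ i, C i := by
      intro e he
      rw [Set.mem_iUnion]
      rcases hzs e he with h | h | h
      exacts [⟨0, (hmem 0 e).1 h⟩, ⟨1, (hmem 1 e).1 h⟩, ⟨2, (hmem 2 e).1 h⟩]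
    clear hzs
    induction hn : z.support.card using Nat.strong_induction_on generalizing z with
    | _ n ih =>
      by_cases hz0 : z = 0
      · exact ⟨0, by simp [hz0]⟩
      -- Adding the contained circuit removes it from the support, so induction on the size applies.
      obtain ⟨i, hi⟩ := hsub z hz hz0 hzC
      have hlt : (z + x i).support ⊂ z.support := by
        refine ⟨fun e he ↦ ?_, fun hle ↦ ?_⟩
        · rw [mem_support_add_iff] at he
          have := @hi e
          tauto
        · obtain ⟨e, he⟩ := Finsupp.support_nonempty_iff.2 (hx i).2.1
          have h1 := hle (hi he)
          rw [mem_support_add_iff] at h1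
          have := @hi e
          tauto
      obtain ⟨y, hy⟩ := ih _ (hn ▸ Finset.card_lt_card hlt) _ (W.add_mem hz (hx i).1)
        ((Finset.coe_subset.2 hlt.1).trans hzC) rfl
      refine ⟨y + Pi.single i 1, ?_⟩
      have : z = z + x i + x i := by rw [add_assoc, finsupp_add_self, add_zero]
      rw [this, hy]
      simp [add_smul, Finset.sum_add_distrib, Pi.single_apply, ite_smul]
  obtain ⟨y, rfl⟩ := key
  exact ⟨y 0, y 1, y 2, by simp [Fin.sum_univ_succ, add_assoc]⟩

end Matroid

theorem theorem1p4 {α : Type*} (M : Matroid α) [M.Finite]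
    (hconn : M.IsConnected) (hbin : M.IsBinary) (hskew : M.HasSkewCircuits 3) :
    ∃ N : Matroid α, N.IsSeriesMinor M ∧
      (N.IsIsomorphic Graph.L₁.cycleMatroid ∨ N.IsIsomorphic Graph.L₂.cycleMatroid ∨
        N.IsIsomorphic Graph.L₃.cycleMatroid ∨ N.IsIsomorphic Graph.L₄.cycleMatroid ∨
        N.IsIsomorphic Graph.L₅.cycleMatroid) := by
  obtain ⟨W, hW⟩ := hbin.exists_isCycleSpace
  obtain ⟨a, b, c, h⟩ := hskew.exists_isSkewTriple hW
  refine h.hasUnavoidableMinor hW fun e he f hf hef ↦ ?_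
  obtain ⟨C, hC, heC, hfC⟩ := hconn he hf hef
  obtain ⟨x, hx, rfl⟩ := hW.exists_of_isCircuit hC
  exact ⟨x, hx, heC, hfC⟩
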